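/- Let $(X,d)$ be a metric space with a Borel measure $\mu$ such that $0<\mu(B(x,r))<\infty$ for every open ball of radius $r\in(0,\infty)$. For a measurable $f:X\to(0,\infty)$ and measurable $E\subseteq X$ write $f_E^-=\operatorname{ess\,inf}_E f$, $f_E^+=\operatorname{ess\,sup}_E f$, $f^\pm=f_X^\pm$. Let $\mathcal P_b^{\log}(X)$ be the set of measurable $f:X\to(0,\infty)$ with $0<f^-\le f^+<\infty$ for which there is $C_{\log}(1/f)>0$ with $|1/f(x)-1/f(y)|\le C_{\log}(1/f)/\log(e+1/d(x,y))$ for all $x,y\in X$. For a measurable $E\subseteq X$ and a bounded exponent $p$, $L^{p(\cdot)}(E)$ is the set of measurable $f$ with $\int_E|f|^{p(x)}\,d\mu<\infty$, with the Luxemburg quasi-norm $\|f\|_{L^{p(\cdot)}(E)}=\inf\{\lambda>0:\int_E|f/\lambda|^{p(x)}\,d\mu\le1\}$ ($\inf\emptyset=\infty$). For a measurable a.e. finite $u$ on $E$, $\mathcal D^{s(\cdot)}(u)$ is the set of functions $g:E\to[0,\infty]$ for which there is a $\mu$-null set $N$ with $|u(x)-u(y)|\le d(x,y)^{s(x)}g(x)+d(x,y)^{s(y)}g(y)$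 for all $x,y\in E\setminus N$; and $u\in\dot M^{s(\cdot),p(\cdot)}(E)$ means that $\inf\|g\|_{L^{p(\cdot)}(E)}<\infty$, the infimum being over the measurable $g\in\mathcal D^{s(\cdot)}(u)$. Write $u_B=\frac1{\mu(B)}\int_B u\,d\mu$. Let $Q,p,s\in\mathcal P_b^{\log}(X)$, $\delta\in(0,\infty)$, $b\in(0,1]$, $\sigma\in(1,\infty)$, and assume that $\mu(B(x,r))\ge b\,r^{Q(x)}$ for all $x\in X$ and $r\in(0,\delta]$. Let $m,M,L\in(0,\infty)$ be such that for each $f\in\{Q,p,s\}$ one has $m\le f^-$, $f^+\le M$, and the log-Hölder condition for $1/f$ holds with constant $L$. Below, $B_0=B(x_0,r_0)$ is any ball with $0<r_0\le\delta/\sigma$, $\sigma B_0=B(x_0,\sigma r_0)$, and $(u,g)$ is any pair with $u\in\dot M^{s(\cdot),p(\cdot)}(\sigma B_0)$ and $g\in\mathcal D^{s(\cdot)}(u)\cap L^{p(\cdot)}(\sigma B_0)$. (i) If $(Q-sp)^-\ge\theta>0$, then, with $\gamma=\frac{Qp}{Q-sp}$, $$\inf_{c\in\mathbb R}\|u-c\|_{L^{\gamma(\cdot)}(B_0)}\le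 C_S\left(\frac{\mu(B_0)}{r_0^{Q(x_0)}}\right)^{1/\gamma^-_{B_0}}\|g\|_{L^{p(\cdot)}(\sigma B_0)},$$ where $C_S>0$ depends only on $b,\sigma,\delta,m,M,L,\theta$. (ii) If $sp=Q$ on $X$, then $u$ is integrable on $B_0$ and, if $\|g\|_{L^{p(\cdot)}(\sigma B_0)}>0$, $$\frac1{\mu(B_0)}\int_{B_0}\exp\left(C_{MT1}\frac{|u(x)-u_{B_0}|}{\|g\|_{L^{p(\cdot)}(\sigma B_0)}}\right)d\mu(x)\le C_{MT2},$$ where $C_{MT1},C_{MT2}>0$ depend only on $b,\sigma,\delta,m,M,L$. (iii) If $(sp-Q)^-\ge\theta>0$, then, with $\alpha=s-Q/p$, $u$ is integrable on $B_0$ and $$\|u-u_{B_0}\|_{L^\infty(B_0)}\le C_H\,r_0^{\alpha(x_0)}\|g\|_{L^{p(\cdot)}(\sigma B_0)};$$ moreover there is a continuous $\tilde u$ on $B_0$ with $u=\tilde u$ a.e. on $B_0$ and, for all $x,y\in B_0$, $$|\tilde u(x)-\tilde u(y)|\le 2^{\alpha^++1}C_H\left(\frac{\sigma\delta}{(\sigma-1)r_0}\right)^{\alpha^+}\|g\|_{L^{p(\cdot)}(\sigma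 B_0)}\,d(x,y)^{\alpha(x)},$$ where $C_H>0$ depends only on $b,\sigma,\delta,m,M,L,\theta$. -/

import Mathlib

open MeasureTheory Set
open scoped ENNReal

universe u

noncomputable section

namespace VarExp

variable {X : Type*}

/-- `p` is a bounded variable exponent with `m ≤ p⁻` and `p⁺ ≤ M` (essential bounds), and `1/p` is
log-Hölder continuous with constant `L`. With `0 < m`, the class of bounded log-Hölder exponents
consists of the `p` for which this holds for some `m`, `M`, `L`. -/
structure IsLogHolderExponent [MetricSpace X] [MeasurableSpace X]
    (μ : Measure X) (m M L : ℝ) (p : X → ℝ) : Prop where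
  measurable : Measurable p
  pos : ∀ x, 0 < p x
  lower : ∀ᵐ x ∂μ, m ≤ p x
  upper : ∀ᵐ x ∂μ, p x ≤ M
  logHolder : ∀ x y, |1 / p x - 1 / p y| ≤ L / Real.log (Real.exp 1 + 1 / dist x y)

/-- Every ball of positive radius has positive and finite measure. -/
def IsMetricMeasure [MetricSpace X] [MeasurableSpace X] (μ : Measure X) : Prop :=
  ∀ (x : X) (r : ℝ), 0 < r → 0 < μ (Metric.ball x r) ∧ μ (Metric.ball x r) < ∞

/-- `μ(B(x,r)) ≥ b r^{Q(x)}` for all `x` and all `0 < r ≤ δ`. -/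
def LowerAhlfors [MetricSpace X] [MeasurableSpace X]
    (μ : Measure X) (b δ : ℝ) (Q : X → ℝ) : Prop :=
  ∀ (x : X) (r : ℝ), 0 < r → r ≤ δ → ENNReal.ofReal (b * r ^ Q x) ≤ μ (Metric.ball x r)

/-- The standing assumptions on a metric measure space and the three exponents on it. -/
structure Admissible [MetricSpace X] [MeasurableSpace X]
    (b δ m M L : ℝ) (μ : Measure X) (Q p s : X → ℝ) : Prop where
  metricMeasure : IsMetricMeasure μ
  dimension : IsLogHolderExponent μ m M L Q
  integrability : IsLogHolderExponent μ m M L p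
  smoothness : IsLogHolderExponent μ m M L s
  lowerAhlfors : LowerAhlfors μ b δ Q

/-- The semi-modular `∫ f^{p(x)} dμ` of a nonnegative extended-valued function. -/
def modular [MeasurableSpace X] (μ : Measure X) (p : X → ℝ) (f : X → ℝ≥0∞) : ℝ≥0∞ :=
  ∫⁻ x, f x ^ p x ∂μ

/-- The Luxemburg quasi-norm of a nonnegative function (of `|v|`, for a real function `v`), with
`inf ∅ = ∞`. -/
def luxNorm [MeasurableSpace X] (μ : Measure X) (p : X → ℝ) (f : X → ℝ≥0∞) : ℝ≥0∞ :=
  sInf {l : ℝ≥0∞ | l ≠ 0 ∧ l ≠ ∞ ∧ modular μ p (fun x => f x / l) ≤ 1}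

/-- Membership of a nonnegative function in the variable exponent Lebesgue space. -/
def MemLpVar [MeasurableSpace X] (μ : Measure X) (p : X → ℝ) (f : X → ℝ≥0∞) : Prop :=
  AEMeasurable f μ ∧ modular μ p f < ∞

/-- `g` is a scalar (Hajłasz) `s(·)`-gradient of `u` on the set `E`. -/
def IsScalarGradient [MetricSpace X] [MeasurableSpace X]
    (μ : Measure X) (E : Set X) (s : X → ℝ) (u : X → ℝ) (g : X → ℝ≥0∞) : Prop :=
  ∃ N : Set X, μ N = 0 ∧ ∀ x ∈ E \ N, ∀ y ∈ E \ N,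
    ENNReal.ofReal |u x - u y| ≤
      ENNReal.ofReal (dist x y ^ s x) * g x + ENNReal.ofReal (dist x y ^ s y) * g y

/-- The homogeneous Hajłasz–Sobolev functional of `u` on `E`: the infimum of the Luxemburg norms
of the measurable scalar gradients of `u`. -/
def hajlaszSeminorm [MetricSpace X] [MeasurableSpace X]
    (μ : Measure X) (E : Set X) (s p : X → ℝ) (u : X → ℝ) : ℝ≥0∞ :=
  ⨅ (g : X → ℝ≥0∞) (_ : AEMeasurable g (μ.restrict E)) (_ : IsScalarGradient μ E s u g),
    luxNorm (μ.restrict E) p g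

/-- Membership in the homogeneous Hajłasz–Sobolev space on `E`; only the values of `u` on `E`
matter. -/
def MemHajlaszSobolev [MetricSpace X] [MeasurableSpace X]
    (μ : Measure X) (E : Set X) (s p : X → ℝ) (u : X → ℝ) : Prop :=
  AEMeasurable u (μ.restrict E) ∧ hajlaszSeminorm μ E s p u < ∞

/-- The admissible pairs: `u` is in the homogeneous Hajłasz–Sobolev space on `E`, and `g` is a
scalar `s(·)`-gradient of `u` on `E` that lies in the variable exponent Lebesgue space on `E`. -/
def IsHajlaszPair [MetricSpace X] [MeasurableSpace X]
    (μ : Measure X) (E : Set X) (s p : X → ℝ) (u : X → ℝ) (g : X → ℝ≥0∞) : Prop :=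
  MemHajlaszSobolev μ E s p u ∧ IsScalarGradient μ E s u g ∧ MemLpVar (μ.restrict E) p g

/-- The Sobolev conjugate exponent `γ = Qp / (Q - sp)`. -/
def sobolevConj (Q p s : X → ℝ) : X → ℝ :=
  fun x => Q x * p x / (Q x - s x * p x)

/-- The Hölder exponent `α = s - Q/p`. -/
def holderExp (Q p s : X → ℝ) : X → ℝ :=
  fun x => s x - Q x / p x

/-- `D_H(r) = 2^{a+1} C (σδ / ((σ-1) r))^a`, to be used with `a = α⁺`. -/
def holderConst (σ δ C a r : ℝ) : ℝ :=
  2 ^ (a + 1) * C * (σ * δ / ((σ - 1) * r)) ^ a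

end VarExp

end

/-! Write `q = Q/p`. Dividing `u` and `g` by a number `l > ‖g‖` makes the modular of `G = g/l` at
most one. The mean of `G^p` over a ball `B(x,r)` inside the large ball is then at most `(b
r^{Q(x)})⁻¹`, so outside any null set some point `y` of that ball has `G(y)^{p(y)}` below this mean.
Since `1/p` is log-Hölder, `r^{-Q(x)/p(y)}` is comparable with `r^{-Q(x)/p(x)}`, so `G(y) ≤ A
r^{-q(x)}` (`Admissible.exists_mem_ball_le`). Only the lower measure bound enters, not doubling.
Telescoping runs over values of `u` at such points rather than over ball averages, so integrability
of `u` is not needed in advance.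

Two good points at scale `ρ` in nearby balls satisfy `|u(y) - u(z)| ≲ ρ^{s(x)-q(x)}`
(`GradientData.link`). Chaining through `B(x, ρ/2^j)` and ending at `x` itself costs the sum of
`(ρ/2^j)^{s(x)-q(x)}` plus a last term `(ρ/2^J)^{s(x)} G(x)`. The chain stops at the scale `t` with
`t^{-q(x)} = max (G x) (ρ^{-q(x)})`, where the last term is at most `t^{s(x)-q(x)}`
(`GradientData.exists_scale`). The sign of `s - q` then separates the three cases.

If `s - q` is negative, the smallest radius dominates and `|u(x) - u(z)| ≲ t^{s-q}`. Since `(s-q)γ =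
-Q`, the `γ`-th power is about `t^{-Q} = max(G, ρ^{-q})^p ≤ G^p + ρ^{-Q}`, whose integral is
controlled.

If `s = q`, every link costs a constant, so `|u(x) - u(z)|` is at most a multiple of the number of
links, about `log₂(ρ/t)`. A small exponential of it is bounded by `(ρ/t)^Q ≤ 1 + ρ^Q G^p`, again
integrable.

If `s - q` is positive, the largest radius dominates. Chaining from both `x` and `y` with `ρ`
comparable to `d(x,y)` gives a Hölder bound on a set of full measure, which is dense, and the
function extends by continuity. -/

noncomputable section

namespace VarExp

open Filter Topology

variable {X : Type*}

/-! ### Logarithmic moduli of continuity. -/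

/-- `f` has modulus of continuity `Λ / log (e + 1 / d)`. -/
def HasLogModulus [MetricSpace X] (Λ : ℝ) (f : X → ℝ) : Prop :=
  ∀ x y, |f x - f y| ≤ Λ / Real.log (Real.exp 1 + 1 / dist x y)

lemma one_le_log_exp_one_add {t : ℝ} (ht : 0 ≤ t) : 1 ≤ Real.log (Real.exp 1 + t) := by
  rw [Real.le_log_iff_exp_le (by positivity)]
  linarith

/-- The factor by which `r ^ f` may vary on a ball of radius `K r`, where `r ≤ δ`, if `f` has
logarithmic modulus of continuity with constant `Λ`. -/
def oscFactor (δ Λ K : ℝ) : ℝ := Real.exp (Λ * (K + 1 + δ))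

lemma one_le_oscFactor {δ Λ K : ℝ} (hδ : 0 < δ) (hΛ : 0 ≤ Λ) (hK : 0 ≤ K) :
    1 ≤ oscFactor δ Λ K :=
  Real.one_le_exp (by positivity)

section LogModulus

variable [MetricSpace X] {Λ : ℝ} {f g : X → ℝ}

lemma HasLogModulus.continuous (hf : HasLogModulus Λ f) : Continuous f := by
  rw [continuous_iff_continuousAt]
  intro x
  rw [ContinuousAt, tendsto_iff_dist_tendsto_zero]
  have h0 : Tendsto (fun y => dist y x) (𝓝[≠] x) (𝓝[>] 0) := by
    rw [tendsto_nhdsWithin_iff]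
    refine ⟨?_, ?_⟩
    · have : Tendsto (fun y => dist y x) (𝓝 x) (𝓝 0) := by
        simpa using (continuous_id.dist (continuous_const (y := x))).tendsto x
      exact this.mono_left nhdsWithin_le_nhds
    · filter_upwards [self_mem_nhdsWithin] with y hy
      exact dist_pos.2 hy
  have h1 : Tendsto (fun y => Λ / Real.log (Real.exp 1 + 1 / dist y x)) (𝓝[≠] x) (𝓝 0) := by
    refine Tendsto.const_div_atTop (Real.tendsto_log_atTop.comp
      (tendsto_atTop_add_const_left _ _ ?_)) _
    simpa [Function.comp_def] using tendsto_inv_nhdsGT_zero.comp h0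
  have h2 : Tendsto (fun y => dist (f y) (f x)) (𝓝[≠] x) (𝓝 0) :=
    squeeze_zero (fun _ => dist_nonneg) (fun y => hf y x) h1
  -- The limit is taken on the punctured neighbourhood because `1 / 0 = 0` makes the modulus equal
  -- to `Λ`, not `0`, at distance zero.
  rw [← nhdsNE_sup_pure, tendsto_sup, tendsto_pure_left]
  refine ⟨h2, fun s hs => ?_⟩
  simpa using mem_of_mem_nhds hs

/-- The denominator of the modulus absorbs `|log r|`. For `r ≤ 1`, `d ≤ K r` gives `-log r ≤ log K -
log d`, and `-log d` is at most the denominator. For `r ≥ 1`, simply `log r ≤ δ`. Exponentiating,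
exponents can be moved between nearby points at bounded cost. -/
lemma HasLogModulus.abs_mul_log_le {δ K r : ℝ} (hf : HasLogModulus Λ f) (hΛ : 0 ≤ Λ)
    (hK : 0 ≤ K) (hr : 0 < r) (hrδ : r ≤ δ) {x y : X} (hxy : dist x y ≤ K * r) :
    |f x - f y| * |Real.log r| ≤ Λ * (K + 1 + δ) := by
  rcases eq_or_ne x y with rfl | hne
  · simp only [sub_self, abs_zero, zero_mul]
    have := hr.trans_le hrδ
    positivity
  have hd : 0 < dist x y := dist_pos.2 hne
  set l := Real.log (Real.exp 1 + 1 / dist x y) with hl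
  have hl1 : 1 ≤ l := one_le_log_exp_one_add (by positivity)
  have hlog : |Real.log r| ≤ (K + 1 + δ) * l := by
    have hδ0 : 0 ≤ δ := hr.le.trans hrδ
    rcases le_total 1 r with h1 | h1
    · rw [abs_of_nonneg (Real.log_nonneg h1)]
      have := Real.log_le_self hr.le
      nlinarith [mul_nonneg hK (zero_le_one.trans hl1), mul_nonneg hδ0 (sub_nonneg.2 hl1)]
    · rw [abs_of_nonpos (Real.log_nonpos hr.le h1)]
      have hK0 : 0 < K := by
        rcases hK.eq_or_lt with h | h
        · rw [← h, zero_mul] at hxy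
          linarith
        · exact h
      have h2 : Real.log (dist x y) ≤ Real.log K + Real.log r := by
        rw [← Real.log_mul hK0.ne' hr.ne']
        exact Real.log_le_log hd hxy
      have h3 : -Real.log (dist x y) ≤ l := by
        rw [← Real.log_inv, hl]
        refine Real.log_le_log (by positivity) ?_
        rw [one_div]
        linarith [Real.exp_pos 1]
      have h4 := Real.log_le_self hK
      nlinarith [mul_nonneg hK (sub_nonneg.2 hl1), mul_nonneg hδ0 (zero_le_one.trans hl1)]
  calc |f x - f y| * |Real.log r| ≤ Λ / l * ((K + 1 + δ) * l) := by
        gcongr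
        exact hf x y
    _ = Λ * (K + 1 + δ) := by field_simp

lemma HasLogModulus.rpow_le {δ K r : ℝ} (hf : HasLogModulus Λ f) (hΛ : 0 ≤ Λ)
    (hK : 0 ≤ K) (hr : 0 < r) (hrδ : r ≤ δ) {x y : X} (hxy : dist x y ≤ K * r) :
    r ^ f x ≤ oscFactor δ Λ K * r ^ f y := by
  rw [oscFactor, Real.rpow_def_of_pos hr, Real.rpow_def_of_pos hr, ← Real.exp_add,
    Real.exp_le_exp]
  have h1 := hf.abs_mul_log_le hΛ hK hr hrδ hxy
  rw [← abs_mul] at h1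
  have h2 := le_abs_self ((f x - f y) * Real.log r)
  linarith

lemma HasLogModulus.neg (hf : HasLogModulus Λ f) : HasLogModulus Λ fun x => -f x := by
  intro x y
  have := hf x y
  rwa [← abs_neg, show -(-f x - -f y) = f x - f y by ring]

lemma HasLogModulus.of_le_mul {L c : ℝ} (hc : 0 ≤ c) (hg : HasLogModulus L g)
    (h : ∀ x y, |f x - f y| ≤ c * |g x - g y|) : HasLogModulus (c * L) f := by
  intro x y
  rw [mul_div_assoc]
  exact (h x y).trans (mul_le_mul_of_nonneg_left (hg x y) hc)

lemma HasLogModulus.add {Λ' : ℝ} (hf : HasLogModulus Λ f) (hg : HasLogModulus Λ' g) :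
    HasLogModulus (Λ + Λ') fun x => f x + g x := by
  intro x y
  rw [add_div]
  calc |f x + g x - (f y + g y)| = |(f x - f y) + (g x - g y)| := by ring_nf
    _ ≤ |f x - f y| + |g x - g y| := abs_add_le _ _
    _ ≤ _ := add_le_add (hf x y) (hg x y)

lemma HasLogModulus.mono {Λ' : ℝ} (hf : HasLogModulus Λ f) (h : Λ ≤ Λ') : HasLogModulus Λ' f := by
  intro x y
  refine (hf x y).trans ?_
  have := one_le_log_exp_one_add (t := 1 / dist x y) (by positivity)
  gcongr

end LogModulus

/-! ### Regularity of the exponents, and passage from almost everywhere to everywhere. -/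

section Exponent

variable [MetricSpace X] [MeasurableSpace X] {μ : Measure X} {m M L : ℝ} {p : X → ℝ}

/-- A measure charging all balls charges all nonempty open sets, so that full measure sets are
dense. -/
lemma IsMetricMeasure.dense_of_ae (hμ : IsMetricMeasure μ) {P : X → Prop} (h : ∀ᵐ x ∂μ, P x) :
    Dense {x | P x} := by
  intro x
  rw [Metric.mem_closure_iff]
  intro ε hε
  by_contra! hcon
  have : Metric.ball x ε ⊆ {x | ¬ P x} := by
    intro y hy hP
    exact absurd (hcon y hP) (not_le.2 (by rwa [dist_comm]))
  exact (hμ x ε hε).1.ne' (measure_mono_null this (ae_iff.1 h))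

lemma IsMetricMeasure.forall_le_of_ae (hμ : IsMetricMeasure μ) {f g : X → ℝ} (hf : Continuous f)
    (hg : Continuous g) (h : ∀ᵐ x ∂μ, f x ≤ g x) (x : X) : f x ≤ g x := by
  have h1 : closure {x | f x ≤ g x} = {x | f x ≤ g x} := (isClosed_le hf hg).closure_eq
  have h2 := hμ.dense_of_ae h x
  rwa [h1] at h2

lemma IsLogHolderExponent.hasLogModulus_one_div (hp : IsLogHolderExponent μ m M L p) :
    HasLogModulus L fun x => 1 / p x :=
  hp.logHolder

lemma IsLogHolderExponent.continuous (hp : IsLogHolderExponent μ m M L p) : Continuous p := by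
  have h := hp.hasLogModulus_one_div.continuous.inv₀ (fun x => (one_div_pos.2 (hp.pos x)).ne')
  refine h.congr fun x => ?_
  simp

lemma IsLogHolderExponent.le (hμ : IsMetricMeasure μ) (hp : IsLogHolderExponent μ m M L p)
    (x : X) : m ≤ p x :=
  hμ.forall_le_of_ae continuous_const hp.continuous hp.lower x

lemma IsLogHolderExponent.le' (hμ : IsMetricMeasure μ) (hp : IsLogHolderExponent μ m M L p)
    (x : X) : p x ≤ M :=
  hμ.forall_le_of_ae hp.continuous continuous_const hp.upper x

/-- The factor `M ^ 2` comes from `p(x) - p(y) = -p(x) p(y) (1/p(x) - 1/p(y))`. -/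
lemma IsLogHolderExponent.hasLogModulus (hμ : IsMetricMeasure μ)
    (hp : IsLogHolderExponent μ m M L p) : HasLogModulus (M ^ 2 * L) p := by
  refine hp.hasLogModulus_one_div.of_le_mul (by positivity) fun x y => ?_
  have hx := hp.pos x
  have hy := hp.pos y
  have h : p x - p y = -(p x * p y) * (1 / p x - 1 / p y) := by
    field_simp
    ring
  rw [h, abs_mul, abs_neg, abs_of_pos (mul_pos hx hy), sq]
  gcongr
  · exact hx.le.trans (hp.le' hμ x)
  · exact hp.le' hμ x
  · exact hp.le' hμ y

lemma IsLogHolderExponent.hasLogModulus_div {q : X → ℝ} (hm : 0 < m) (hM : 0 ≤ M)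
    (hμ : IsMetricMeasure μ) (hp : IsLogHolderExponent μ m M L p)
    (hq : IsLogHolderExponent μ m M L q) :
    HasLogModulus (M * L + 1 / m * (M ^ 2 * L)) fun x => q x / p x := by
  intro x y
  have h : q x / p x - q y / p y = q x * (1 / p x - 1 / p y) + 1 / p y * (q x - q y) := by ring
  rw [h, add_div, mul_div_assoc, mul_div_assoc]
  refine (abs_add_le _ _).trans (add_le_add ?_ ?_)
  · rw [abs_mul, abs_of_pos (hq.pos x)]
    exact mul_le_mul (hq.le' hμ x) (hp.logHolder x y) (abs_nonneg _) hM
  · rw [abs_mul, abs_of_pos (one_div_pos.2 (hp.pos y))]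
    exact mul_le_mul (one_div_le_one_div_of_le hm (hp.le hμ y)) (hq.hasLogModulus hμ x y)
      (abs_nonneg _) (by positivity)

end Exponent

/-! ### Chaining through points with small gradient. -/

/-- Pointwise data extracted from a Hajłasz pair: `G` is a scalar `s(·)`-gradient of `u` on the
set `S`, and every ball `B(x,r) ⊆ E` with `r ≤ δ` contains a point of `S` at which
`G ≤ A r^{-q(x)}`. -/
structure GradientData [MetricSpace X] (δ Λ R A : ℝ) (E S : Set X) (s q u G : X → ℝ) : Prop where
  δ_pos : 0 < δ
  Λ_nonneg : 0 ≤ Λ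
  R_nonneg : 0 ≤ R
  A_nonneg : 0 ≤ A
  s_nonneg : ∀ x, 0 ≤ s x
  s_le : ∀ x, s x ≤ R
  q_pos : ∀ x, 0 < q x
  q_le : ∀ x, q x ≤ R
  s_log : HasLogModulus Λ s
  q_log : HasLogModulus Λ q
  G_nonneg : ∀ x, 0 ≤ G x
  grad : ∀ x ∈ S, ∀ y ∈ S, |u x - u y| ≤ dist x y ^ s x * G x + dist x y ^ s y * G y
  pick : ∀ x r, 0 < r → r ≤ δ → Metric.ball x r ⊆ E →
    ∃ y ∈ S, y ∈ Metric.ball x r ∧ G y ≤ A * r ^ (-q x)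

/-- The constant in the oscillation estimate between two balls of the same radius `ρ` with centres
at distance at most `K ρ`. -/
def linkConst (δ Λ R K A : ℝ) : ℝ :=
  2 * (K + 2) ^ R * oscFactor δ Λ (K + 1) ^ 2 * A

/-- The constant in the telescoping estimate. -/
def chainConst (δ Λ R A : ℝ) : ℝ := linkConst δ Λ R 0 (2 ^ R * A)

namespace GradientData

variable [MetricSpace X] {δ Λ R A : ℝ} {E S : Set X} {s q u G : X → ℝ}

/-- Both points lie within `(K+1) ρ` of `x`, so the exponents `s(y)`, `s(z)` and `q(x')` can be
replaced by those at `x` at the cost of one oscillation factor each. Each of the two gradient terms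
is then about `ρ^{s(x)} · A' ρ^{-q(x)}`. -/
lemma link (h : GradientData δ Λ R A E S s q u G) {K A' ρ : ℝ} (hK : 0 ≤ K) (hA' : 0 ≤ A')
    (hρ : 0 < ρ) (hρδ : ρ ≤ δ) {x x' y z : X} (hxx' : dist x x' ≤ K * ρ)
    (hy : y ∈ S) (hyx : dist y x ≤ ρ) (hGy : G y ≤ A' * ρ ^ (-q x))
    (hz : z ∈ S) (hzx : dist z x' ≤ ρ) (hGz : G z ≤ A' * ρ ^ (-q x')) :
    |u y - u z| ≤ linkConst δ Λ R K A' * ρ ^ (s x - q x) := by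
  set W := oscFactor δ Λ (K + 1) with hW
  have hW1 : 1 ≤ W := one_le_oscFactor h.δ_pos h.Λ_nonneg (by positivity)
  have hW0 : 0 ≤ W := zero_le_one.trans hW1
  have hxz : dist z x ≤ (K + 1) * ρ := by
    have := dist_triangle z x' x
    rw [dist_comm x' x] at this
    linarith
  have hyz : dist y z ≤ (K + 2) * ρ := by
    have := dist_triangle y x z
    rw [dist_comm x z] at this
    linarith
  have key : ∀ w, dist w x ≤ (K + 1) * ρ →
      dist y z ^ s w ≤ (K + 2) ^ R * (W * ρ ^ s x) := by
    intro w hw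
    calc dist y z ^ s w ≤ ((K + 2) * ρ) ^ s w :=
          Real.rpow_le_rpow dist_nonneg hyz (h.s_nonneg w)
      _ = (K + 2) ^ s w * ρ ^ s w := Real.mul_rpow (by positivity) hρ.le
      _ ≤ (K + 2) ^ R * (W * ρ ^ s x) := by
          refine mul_le_mul (Real.rpow_le_rpow_of_exponent_le (by linarith) (h.s_le w)) ?_
            (by positivity) (by positivity)
          exact h.s_log.rpow_le h.Λ_nonneg (by positivity) hρ hρδ hw
  have hGy' : G y ≤ A' * (W * ρ ^ (-q x)) := by
    refine hGy.trans (mul_le_mul_of_nonneg_left ?_ hA')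
    exact le_mul_of_one_le_left (by positivity) hW1
  have hGz' : G z ≤ A' * (W * ρ ^ (-q x)) := by
    refine hGz.trans (mul_le_mul_of_nonneg_left ?_ hA')
    refine h.q_log.neg.rpow_le h.Λ_nonneg (by positivity) hρ hρδ ?_
    rw [dist_comm]
    linarith
  have hyx' : dist y x ≤ (K + 1) * ρ := by nlinarith
  calc |u y - u z| ≤ dist y z ^ s y * G y + dist y z ^ s z * G z := h.grad y hy z hz
    _ ≤ (K + 2) ^ R * (W * ρ ^ s x) * (A' * (W * ρ ^ (-q x))) +
        (K + 2) ^ R * (W * ρ ^ s x) * (A' * (W * ρ ^ (-q x))) := by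
      gcongr
      · exact h.G_nonneg y
      · exact key y hyx'
      · exact h.G_nonneg z
      · exact key z hxz
    _ = linkConst δ Λ R K A' * ρ ^ (s x - q x) := by
      rw [linkConst, ← hW, Real.rpow_sub hρ, Real.rpow_neg hρ.le]
      field_simp
      ring

lemma linkConst_nonneg (h : GradientData δ Λ R A E S s q u G) {K A' : ℝ} (hK : 0 ≤ K)
    (hA' : 0 ≤ A') : 0 ≤ linkConst δ Λ R K A' := by
  have := one_le_oscFactor h.δ_pos h.Λ_nonneg (K := K + 1) (by positivity)
  unfold linkConst
  positivity

lemma chainConst_nonneg (h : GradientData δ Λ R A E S s q u G) : 0 ≤ chainConst δ Λ R A := by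
  have := h.A_nonneg
  exact h.linkConst_nonneg le_rfl (by positivity)

/-- Telescoping over the radii `ρ, ρ/2, …, ρ/2^J` of balls centred at `x`. -/
lemma chain (h : GradientData δ Λ R A E S s q u G) {x : X} (hx : x ∈ S) (J : ℕ) :
    ∀ {ρ : ℝ}, 0 < ρ → ρ ≤ δ → Metric.ball x ρ ⊆ E →
      ∃ y ∈ S, y ∈ Metric.ball x ρ ∧ G y ≤ A * ρ ^ (-q x) ∧
        |u x - u y| ≤ (ρ / 2 ^ J) ^ s x * G x +
          chainConst δ Λ R A * ∑ j ∈ Finset.range (J + 1), (ρ / 2 ^ j) ^ (s x - q x) := by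
  induction J with
  | zero =>
    intro ρ hρ hρδ hball
    obtain ⟨y, hy, hyx, hGy⟩ := h.pick x ρ hρ hρδ hball
    refine ⟨y, hy, hyx, hGy, ?_⟩
    have hA := h.A_nonneg
    have hW1 := one_le_oscFactor h.δ_pos h.Λ_nonneg (K := 1) zero_le_one
    have h2 : (1 : ℝ) ≤ 2 ^ R := Real.one_le_rpow one_le_two h.R_nonneg
    have hd : dist x y ≤ ρ := by
      rw [dist_comm]
      exact (Metric.mem_ball.1 hyx).le
    have h3 : dist x y ^ s y ≤ oscFactor δ Λ 1 * ρ ^ s x := by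
      refine (Real.rpow_le_rpow dist_nonneg hd (h.s_nonneg y)).trans ?_
      refine h.s_log.rpow_le h.Λ_nonneg zero_le_one hρ hρδ ?_
      rwa [dist_comm, one_mul]
    have hC : oscFactor δ Λ 1 * A ≤ chainConst δ Λ R A := by
      rw [chainConst, linkConst, zero_add, zero_add]
      have : oscFactor δ Λ 1 * A = 1 * 1 * (oscFactor δ Λ 1 * 1) * (1 * A) := by ring
      rw [this, sq]
      gcongr
      linarith
    simp only [pow_zero, div_one, zero_add, Finset.sum_range_one]
    calc |u x - u y| ≤ dist x y ^ s x * G x + dist x y ^ s y * G y := h.grad x hx y hy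
      _ ≤ ρ ^ s x * G x + oscFactor δ Λ 1 * ρ ^ s x * (A * ρ ^ (-q x)) := by
        gcongr
        · exact h.G_nonneg x
        · exact h.s_nonneg x
        · exact h.G_nonneg y
      _ = ρ ^ s x * G x + oscFactor δ Λ 1 * A * ρ ^ (s x - q x) := by
        rw [Real.rpow_sub hρ, Real.rpow_neg hρ.le]
        ring
      _ ≤ _ := by gcongr
  | succ J ih =>
    intro ρ hρ hρδ hball
    have hA := h.A_nonneg
    -- The induction adds the outermost link: the chain for `ρ/2` is extended by one step from its
    -- end point `z` to a point of the ball of radius `ρ`. At scale `ρ` the bound at `z` worsens by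
    -- `2^{q(x)} ≤ 2^R`, which is why `chainConst` contains `2^R A`.
    obtain ⟨z, hz, hzx, hGz, hxz⟩ := ih (ρ := ρ / 2) (by positivity) (by linarith)
      ((Metric.ball_subset_ball (by linarith)).trans hball)
    obtain ⟨y, hy, hyx, hGy⟩ := h.pick x ρ hρ hρδ hball
    refine ⟨y, hy, hyx, hGy, ?_⟩
    have h2 : (1 : ℝ) ≤ 2 ^ R := Real.one_le_rpow one_le_two h.R_nonneg
    have hlink : |u z - u y| ≤ chainConst δ Λ R A * ρ ^ (s x - q x) := by
      refine h.link le_rfl (by positivity) hρ hρδ (x' := x) (by simp) hz ?_ ?_ hy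
        (Metric.mem_ball.1 hyx).le ?_
      · have := Metric.mem_ball.1 hzx
        linarith
      · refine hGz.trans ?_
        rw [Real.div_rpow hρ.le zero_le_two, Real.rpow_neg zero_le_two, div_inv_eq_mul]
        have : (2 : ℝ) ^ q x ≤ 2 ^ R := Real.rpow_le_rpow_of_exponent_le one_le_two (h.q_le x)
        calc A * (ρ ^ (-q x) * 2 ^ q x) ≤ A * (ρ ^ (-q x) * 2 ^ R) := by gcongr
          _ = _ := by ring
      · refine hGy.trans ?_
        gcongr
        exact le_mul_of_one_le_left hA h2
    have hpow : ∀ j : ℕ, ρ / 2 / 2 ^ j = ρ / 2 ^ (j + 1) := by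
      intro j
      rw [pow_succ]
      field_simp
    simp only [hpow] at hxz
    rw [Finset.sum_range_succ', pow_zero, div_one]
    have := abs_sub_le (u x) (u z) (u y)
    linarith

/-- The telescoping estimate, stopped at the scale `t` with `t^{-q(x)} = max (G x) ρ^{-q(x)}`. -/
lemma exists_scale (h : GradientData δ Λ R A E S s q u G) {x : X} (hx : x ∈ S) {ρ : ℝ}
    (hρ : 0 < ρ) (hρδ : ρ ≤ δ) (hball : Metric.ball x ρ ⊆ E) :
    ∃ (t : ℝ) (J : ℕ) (y : X), 0 < t ∧ t ≤ ρ ∧ t ^ (-q x) = max (G x) (ρ ^ (-q x)) ∧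
      ρ / 2 ^ J ≤ t ∧ t ≤ 2 * (ρ / 2 ^ J) ∧ y ∈ S ∧ y ∈ Metric.ball x ρ ∧
      G y ≤ A * ρ ^ (-q x) ∧
      |u x - u y| ≤ t ^ (s x - q x) +
        chainConst δ Λ R A * ∑ j ∈ Finset.range (J + 1), (ρ / 2 ^ j) ^ (s x - q x) := by
  have hq := h.q_pos x
  set H := max (G x) (ρ ^ (-q x)) with hH
  have hρq : 0 < ρ ^ (-q x) := by positivity
  have hH0 : 0 < H := hρq.trans_le (le_max_right _ _)
  set t := H ^ (-(q x)⁻¹) with ht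
  have ht0 : 0 < t := by positivity
  have htq : t ^ (-q x) = H := by
    rw [ht, ← Real.rpow_mul hH0.le, neg_mul_neg, inv_mul_cancel₀ hq.ne', Real.rpow_one]
  have htρ : t ≤ ρ := by
    by_contra! hlt
    have := Real.rpow_lt_rpow_of_neg hρ hlt (neg_neg_of_pos hq)
    rw [htq] at this
    exact absurd (le_max_right _ _) (not_le.2 this)
  -- With `2^n ≤ ρ/t < 2^{n+1}`, the choice `J = n + 1` puts the last radius below `t` but not below
  -- `t/2`.
  obtain ⟨n, hn1, hn2⟩ := exists_nat_pow_near (x := ρ / t) (y := 2) ((one_le_div ht0).2 htρ)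
    one_lt_two
  rw [le_div_iff₀ ht0] at hn1
  rw [div_lt_iff₀ ht0] at hn2
  obtain ⟨y, hy, hyx, hGy, hxy⟩ := h.chain hx (n + 1) hρ hρδ hball
  have hJ : ρ / 2 ^ (n + 1) ≤ t := by
    rw [div_le_iff₀ (by positivity)]
    linarith
  refine ⟨t, n + 1, y, ht0, htρ, htq, hJ, ?_, hy, hyx, hGy, hxy.trans ?_⟩
  · rw [pow_succ]
    have : 2 * (ρ / (2 ^ n * 2)) = ρ / 2 ^ n := by field_simp
    rw [this, le_div_iff₀ (by positivity)]
    linarith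
  · gcongr
    rw [sub_eq_add_neg, Real.rpow_add ht0, htq]
    gcongr
    · exact h.G_nonneg x
    · exact h.s_nonneg x
    · exact le_max_left _ _

end GradientData

/-! ### Geometric sums and the three pointwise estimates. -/

lemma sum_div_two_pow_rpow_le {ρ a a₀ : ℝ} (hρ : 0 < ρ) (ha₀ : 0 < a₀) (ha : a₀ ≤ a) (n : ℕ) :
    ∑ j ∈ Finset.range n, (ρ / 2 ^ j) ^ a ≤ (1 - 2 ^ (-a₀))⁻¹ * ρ ^ a := by
  have hb : (2 : ℝ) ^ (-a₀) < 1 := Real.rpow_lt_one_of_one_lt_of_neg one_lt_two (by linarith)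
  have hb0 : (0 : ℝ) ≤ 2 ^ (-a₀) := by positivity
  calc ∑ j ∈ Finset.range n, (ρ / 2 ^ j) ^ a
      ≤ ∑ j ∈ Finset.range n, ((2 : ℝ) ^ (-a₀)) ^ j * ρ ^ a := by
        refine Finset.sum_le_sum fun j _ => ?_
        rw [Real.div_rpow hρ.le (by positivity), div_eq_mul_inv, mul_comm]
        gcongr
        rw [← Real.rpow_natCast, ← Real.rpow_natCast, ← Real.rpow_mul zero_le_two,
          ← Real.rpow_mul zero_le_two, ← Real.rpow_neg zero_le_two]
        refine Real.rpow_le_rpow_of_exponent_le one_le_two ?_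
        nlinarith [Nat.cast_nonneg (α := ℝ) j]
    _ = (∑ j ∈ Finset.range n, ((2 : ℝ) ^ (-a₀)) ^ j) * ρ ^ a := by rw [Finset.sum_mul]
    _ ≤ (1 - 2 ^ (-a₀))⁻¹ * ρ ^ a := by
        gcongr
        rw [← tsum_geometric_of_lt_one hb0 hb]
        exact (summable_geometric_of_lt_one hb0 hb).sum_le_tsum _ fun j _ => by positivity

/-- Read from the smallest radius upwards, the sum is again geometric with ratio at most `2^{-a₀}`,
so the last term dominates. -/
lemma sum_div_two_pow_rpow_le_of_neg {ρ a a₀ : ℝ} (hρ : 0 < ρ) (ha₀ : 0 < a₀) (ha : a ≤ -a₀)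
    (J : ℕ) :
    ∑ j ∈ Finset.range (J + 1), (ρ / 2 ^ j) ^ a ≤ (1 - 2 ^ (-a₀))⁻¹ * (ρ / 2 ^ J) ^ a := by
  have h := sum_div_two_pow_rpow_le (ρ := (ρ / 2 ^ J)⁻¹) (a := -a) (by positivity) ha₀
    (by linarith) (J + 1)
  have e : ((ρ / 2 ^ J)⁻¹) ^ (-a) = (ρ / 2 ^ J) ^ a := by
    rw [Real.rpow_neg (by positivity), Real.inv_rpow (by positivity), inv_inv]
  rw [e] at h
  refine le_trans (le_of_eq ?_) h
  rw [← Finset.sum_range_reflect]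
  refine Finset.sum_congr rfl fun j hj => ?_
  have hj' : j ≤ J := Nat.lt_succ_iff.1 (Finset.mem_range.1 hj)
  rw [Real.rpow_neg (by positivity), ← Real.inv_rpow (by positivity)]
  congr 1
  have h1 : J + 1 - 1 - j = J - j := by omega
  rw [h1]
  have h2 : (2 : ℝ) ^ J = 2 ^ (J - j) * 2 ^ j := by rw [← pow_add, Nat.sub_add_cancel hj']
  rw [h2]
  field_simp

/-- The constant in the pointwise estimates in the subcritical and supercritical cases. -/
def powerConst (δ Λ R A K a₀ : ℝ) : ℝ :=
  1 + chainConst δ Λ R A * ((1 - 2 ^ (-a₀))⁻¹ * 2 ^ R) + linkConst δ Λ R K A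

/-- The constant in the pointwise estimate in the critical case. -/
def critConst (δ Λ R A K : ℝ) : ℝ :=
  1 + chainConst δ Λ R A + linkConst δ Λ R K A

lemma inv_one_sub_two_rpow_neg_pos {a₀ : ℝ} (ha₀ : 0 < a₀) : 0 < (1 - (2 : ℝ) ^ (-a₀))⁻¹ :=
  inv_pos.2 (sub_pos.2 (Real.rpow_lt_one_of_one_lt_of_neg one_lt_two (by linarith)))

namespace GradientData

variable [MetricSpace X] {δ Λ R A : ℝ} {E S : Set X} {s q u G : X → ℝ}

lemma one_le_powerConst (h : GradientData δ Λ R A E S s q u G) {K a₀ : ℝ} (hK : 0 ≤ K)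
    (ha₀ : 0 < a₀) : 1 ≤ powerConst δ Λ R A K a₀ := by
  have h1 := h.chainConst_nonneg
  have h2 := h.linkConst_nonneg hK h.A_nonneg
  have h3 := inv_one_sub_two_rpow_neg_pos ha₀
  have h4 : 0 ≤ chainConst δ Λ R A * ((1 - 2 ^ (-a₀))⁻¹ * 2 ^ R) := by positivity
  unfold powerConst
  linarith

/-- The geometric sum is dominated by the smallest radius, which is comparable with `t`. The final
link to the fixed point `z` is of size `ρ^{s-q} ≤ t^{s-q}`. -/
lemma abs_sub_le_of_subcritical (h : GradientData δ Λ R A E S s q u G) {K a₀ ρ : ℝ} (hK : 0 ≤ K)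
    (ha₀ : 0 < a₀) (hα : ∀ x, s x - q x ≤ -a₀) (hρ : 0 < ρ) (hρδ : ρ ≤ δ) {x x₀ z : X}
    (hx : x ∈ S) (hball : Metric.ball x ρ ⊆ E) (hxx₀ : dist x x₀ ≤ K * ρ) (hz : z ∈ S)
    (hzx : dist z x₀ ≤ ρ) (hGz : G z ≤ A * ρ ^ (-q x₀)) :
    ∃ t, 0 < t ∧ t ^ (-q x) = max (G x) (ρ ^ (-q x)) ∧
      |u x - u z| ≤ powerConst δ Λ R A K a₀ * t ^ (s x - q x) := by
  obtain ⟨t, J, y, ht, htρ, htq, hJt, htJ, hy, hyx, hGy, hxy⟩ := h.exists_scale hx hρ hρδ hball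
  refine ⟨t, ht, htq, ?_⟩
  have hlink := h.link hK h.A_nonneg hρ hρδ hxx₀ hy (Metric.mem_ball.1 hyx).le hGy hz hzx hGz
  have hα0 : s x - q x ≤ 0 := by linarith [hα x]
  have h1 : ρ ^ (s x - q x) ≤ t ^ (s x - q x) := Real.rpow_le_rpow_of_nonpos ht htρ hα0
  have h2 : (ρ / 2 ^ J) ^ (s x - q x) ≤ 2 ^ R * t ^ (s x - q x) := by
    calc (ρ / 2 ^ J) ^ (s x - q x) ≤ (t / 2) ^ (s x - q x) :=
          Real.rpow_le_rpow_of_nonpos (by positivity) (by linarith) hα0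
      _ = 2 ^ (-(s x - q x)) * t ^ (s x - q x) := by
          rw [Real.div_rpow ht.le zero_le_two, Real.rpow_neg zero_le_two]
          field_simp
      _ ≤ 2 ^ R * t ^ (s x - q x) := by
          gcongr
          · exact one_le_two
          · linarith [h.q_le x, h.s_nonneg x]
  have h3 := sum_div_two_pow_rpow_le_of_neg hρ ha₀ (hα x) J
  have h4 := (inv_one_sub_two_rpow_neg_pos ha₀).le
  have h5 := h.chainConst_nonneg
  have h6 := h.linkConst_nonneg hK h.A_nonneg
  calc |u x - u z| ≤ |u x - u y| + |u y - u z| := abs_sub_le _ _ _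
    _ ≤ t ^ (s x - q x) + chainConst δ Λ R A * ((1 - 2 ^ (-a₀))⁻¹ * (2 ^ R * t ^ (s x - q x))) +
        linkConst δ Λ R K A * t ^ (s x - q x) := by
      refine add_le_add (hxy.trans ?_) (hlink.trans ?_)
      · gcongr
        refine h3.trans ?_
        gcongr
      · gcongr
    _ = _ := by
      unfold powerConst
      ring

/-- All powers `(ρ/2^j)^{s-q}` equal one, so the chain costs a constant times its length, which is
logarithmic in `ρ/t`. -/
lemma abs_sub_le_of_critical (h : GradientData δ Λ R A E S s q u G) {K ρ : ℝ} (hK : 0 ≤ K)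
    (hα : ∀ x, s x = q x) (hρ : 0 < ρ) (hρδ : ρ ≤ δ) {x x₀ z : X}
    (hx : x ∈ S) (hball : Metric.ball x ρ ⊆ E) (hxx₀ : dist x x₀ ≤ K * ρ) (hz : z ∈ S)
    (hzx : dist z x₀ ≤ ρ) (hGz : G z ≤ A * ρ ^ (-q x₀)) :
    ∃ (t : ℝ) (J : ℕ), 0 < t ∧ t ≤ ρ ∧ t ^ (-q x) = max (G x) (ρ ^ (-q x)) ∧
      2 ^ J ≤ 2 * (ρ / t) ∧ |u x - u z| ≤ critConst δ Λ R A K * (J + 1) := by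
  obtain ⟨t, J, y, ht, htρ, htq, hJt, htJ, hy, hyx, hGy, hxy⟩ := h.exists_scale hx hρ hρδ hball
  refine ⟨t, J, ht, htρ, htq, ?_, ?_⟩
  · rw [← mul_div_assoc, le_div_iff₀ ht]
    rw [← mul_div_assoc, le_div_iff₀ (by positivity)] at htJ
    linarith
  have hlink := h.link hK h.A_nonneg hρ hρδ hxx₀ hy (Metric.mem_ball.1 hyx).le hGy hz hzx hGz
  simp only [hα x, sub_self, Real.rpow_zero, Finset.sum_const, Finset.card_range, nsmul_eq_mul,
    mul_one] at hxy hlink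
  push_cast at hxy
  have h6 := h.linkConst_nonneg hK h.A_nonneg
  have hJ : (0 : ℝ) ≤ J := J.cast_nonneg
  calc |u x - u z| ≤ |u x - u y| + |u y - u z| := abs_sub_le _ _ _
    _ ≤ critConst δ Λ R A K * (J + 1) := by
      unfold critConst
      nlinarith [mul_nonneg h6 hJ]

/-- Chains from `x` and from `y` are dominated by their largest radius `ρ = τ d(x,y)`, and one link
joins their ends. The factor `τ` keeps both balls inside `E`. Log-Hölder continuity turns the
exponent at `y` into the exponent at `x`. -/
lemma abs_sub_le_of_supercritical (h : GradientData δ Λ R A E S s q u G) {τ a₀ : ℝ} (hτ : 0 < τ)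
    (hτ1 : τ ≤ 1) (ha₀ : 0 < a₀) (hα : ∀ x, a₀ ≤ s x - q x) {x y : X} (hx : x ∈ S) (hy : y ∈ S)
    (hdδ : τ * dist x y ≤ δ) (hxE : Metric.ball x (τ * dist x y) ⊆ E)
    (hyE : Metric.ball y (τ * dist x y) ⊆ E) :
    |u x - u y| ≤ 2 * powerConst δ Λ R A τ⁻¹ a₀ * oscFactor δ (Λ + Λ) τ⁻¹ *
      dist x y ^ (s x - q x) := by
  have hK : 0 ≤ τ⁻¹ := by positivity
  have hC1 := h.one_le_powerConst hK ha₀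
  have hΛ := h.Λ_nonneg
  have hW1 := one_le_oscFactor h.δ_pos (Λ := Λ + Λ) (by positivity) hK
  rcases eq_or_ne x y with rfl | hne
  · simp only [sub_self, abs_zero]
    positivity
  have hd : 0 < dist x y := dist_pos.2 hne
  set ρ := τ * dist x y with hρdef
  have hρ : 0 < ρ := by positivity
  have hxy : dist x y = τ⁻¹ * ρ := by
    rw [hρdef]
    field_simp
  have hD := h.chainConst_nonneg
  have h4 := inv_one_sub_two_rpow_neg_pos ha₀
  have h2 : (1 : ℝ) ≤ 2 ^ R := Real.one_le_rpow one_le_two h.R_nonneg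
  have key : ∀ w ∈ S, Metric.ball w ρ ⊆ E → ∃ w' ∈ S, dist w' w ≤ ρ ∧ G w' ≤ A * ρ ^ (-q w) ∧
      |u w - u w'| ≤ (1 + chainConst δ Λ R A * ((1 - 2 ^ (-a₀))⁻¹ * 2 ^ R)) *
        ρ ^ (s w - q w) := by
    intro w hw hwE
    obtain ⟨t, J, w', ht, htρ, -, -, -, hw', hw'x, hGw', hww'⟩ := h.exists_scale hw hρ hdδ hwE
    refine ⟨w', hw', (Metric.mem_ball.1 hw'x).le, hGw', hww'.trans ?_⟩
    have h1 : t ^ (s w - q w) ≤ ρ ^ (s w - q w) :=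
      Real.rpow_le_rpow ht.le htρ (ha₀.le.trans (hα w))
    have h3 := sum_div_two_pow_rpow_le hρ ha₀ (hα w) (J + 1)
    calc _ ≤ ρ ^ (s w - q w) +
          chainConst δ Λ R A * ((1 - 2 ^ (-a₀))⁻¹ * 2 ^ R * ρ ^ (s w - q w)) := by
          gcongr
          refine h3.trans ?_
          gcongr
          exact le_mul_of_one_le_right h4.le h2
      _ = _ := by ring
  set C := 1 + chainConst δ Λ R A * ((1 - 2 ^ (-a₀))⁻¹ * 2 ^ R) with hC
  have hC0 : 0 ≤ C := by positivity
  obtain ⟨x', hx', hx'x, hGx', hxx'⟩ := key x hx hxE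
  obtain ⟨y', hy', hy'y, hGy', hyy'⟩ := key y hy hyE
  have hlink := h.link hK h.A_nonneg hρ hdδ hxy.le hx' hx'x hGx' hy' hy'y hGy'
  have hαlog : HasLogModulus (Λ + Λ) fun x => s x - q x := h.s_log.add h.q_log.neg
  have hcomp : ρ ^ (s y - q y) ≤ oscFactor δ (Λ + Λ) τ⁻¹ * ρ ^ (s x - q x) := by
    refine hαlog.rpow_le (by positivity) hK hρ hdδ ?_
    rw [dist_comm]
    exact hxy.le
  have hl := h.linkConst_nonneg hK h.A_nonneg
  have hρd : ρ ^ (s x - q x) ≤ dist x y ^ (s x - q x) :=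
    Real.rpow_le_rpow hρ.le (mul_le_of_le_one_left hd.le hτ1) (ha₀.le.trans (hα x))
  set P := powerConst δ Λ R A τ⁻¹ a₀ with hP
  have hPC : P = C + linkConst δ Λ R τ⁻¹ A := rfl
  set W := oscFactor δ (Λ + Λ) τ⁻¹
  calc |u x - u y| ≤ |u x - u x'| + |u x' - u y'| + |u y - u y'| := by
        have h1 := abs_sub_le (u x) (u x') (u y)
        have h2 := abs_sub_le (u x') (u y') (u y)
        rw [abs_sub_comm (u y') (u y)] at h2
        linarith
    _ ≤ C * ρ ^ (s x - q x) + linkConst δ Λ R τ⁻¹ A * ρ ^ (s x - q x) +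
        C * (W * ρ ^ (s x - q x)) := by
        gcongr
        exact hyy'.trans (by gcongr)
    _ = (P + C * W) * ρ ^ (s x - q x) := by rw [hPC]; ring
    _ ≤ (2 * P * W) * dist x y ^ (s x - q x) := by
        gcongr
        have h7 : P ≤ P * W := le_mul_of_one_le_right (by linarith) hW1
        have h8 : C * W ≤ P * W := by
          gcongr
          linarith
        linarith

end GradientData

/-! ### The modular and the Luxemburg quasi-norm. -/

section Modular

variable [MeasurableSpace X] {μ : Measure X} {p : X → ℝ} {f : X → ℝ≥0∞}

lemma modular_div_le_one_of_luxNorm_lt (hp : ∀ x, 0 ≤ p x) {l : ℝ≥0∞} (h : luxNorm μ p f < l) :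
    modular μ p (fun x => f x / l) ≤ 1 := by
  obtain ⟨k, ⟨-, -, hk⟩, hkl⟩ := sInf_lt_iff.1 h
  refine le_trans (lintegral_mono fun x => ?_) hk
  exact ENNReal.rpow_le_rpow (ENNReal.div_le_div_left hkl.le _) (hp x)

lemma luxNorm_le_of_modular_le_one {l : ℝ≥0∞} (h0 : l ≠ 0) (ht : l ≠ ∞)
    (h : modular μ p (fun x => f x / l) ≤ 1) : luxNorm μ p f ≤ l :=
  sInf_le ⟨h0, ht, h⟩

lemma luxNorm_lt_top {m : ℝ} (hm : 0 < m) (hp : ∀ x, m ≤ p x) (h : modular μ p f < ∞) :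
    luxNorm μ p f < ∞ := by
  set I := (modular μ p f).toReal with hI
  have hI0 : 0 ≤ I := ENNReal.toReal_nonneg
  -- This `l` is at least one, so `l^{p(x)} ≥ l^m = 1 + I`, and dividing by `l` brings the modular
  -- below one.
  set l : ℝ := (1 + I) ^ m⁻¹ with hl
  have hl1 : 1 ≤ l := Real.one_le_rpow (by linarith) (by positivity)
  have hl0 : 0 < l := by linarith
  have hlm : l ^ m = 1 + I := by
    rw [hl, ← Real.rpow_mul (by linarith), inv_mul_cancel₀ hm.ne', Real.rpow_one]
  refine (luxNorm_le_of_modular_le_one (l := ENNReal.ofReal l) (by simpa using hl0)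
    ENNReal.ofReal_ne_top ?_).trans_lt ENNReal.ofReal_lt_top
  have hpt : ∀ x, (f x / ENNReal.ofReal l) ^ p x ≤ (ENNReal.ofReal (1 + I))⁻¹ * f x ^ p x := by
    intro x
    have hpx : 0 < p x := hm.trans_le (hp x)
    rw [ENNReal.div_rpow_of_nonneg _ _ hpx.le, div_eq_mul_inv, mul_comm,
      ENNReal.ofReal_rpow_of_pos hl0]
    gcongr
    rw [← hlm]
    exact Real.rpow_le_rpow_of_exponent_le hl1 (hp x)
  have h1I : 0 < 1 + I := by linarith
  calc modular μ p (fun x => f x / ENNReal.ofReal l)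
      ≤ ∫⁻ x, (ENNReal.ofReal (1 + I))⁻¹ * f x ^ p x ∂μ := lintegral_mono hpt
    _ = (ENNReal.ofReal (1 + I))⁻¹ * modular μ p f := by
        rw [lintegral_const_mul' _ _ (by simpa using h1I), modular]
    _ ≤ (ENNReal.ofReal (1 + I))⁻¹ * ENNReal.ofReal (1 + I) := by
        gcongr
        rw [← ENNReal.ofReal_toReal h.ne, ← hI]
        exact ENNReal.ofReal_le_ofReal (by linarith)
    _ = 1 := ENNReal.inv_mul_cancel (by simpa using h1I) ENNReal.ofReal_ne_top

end Modular

/-! ### Pointwise data of a Hajłasz pair. -/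

/-- The constant `Λ` of the data extracted from a Hajłasz pair. -/
def dataΛ (m M L : ℝ) : ℝ := M ^ 2 * L + (M * L + 1 / m * (M ^ 2 * L))

/-- The constant `R` of the data extracted from a Hajłasz pair. -/
def dataR (m M : ℝ) : ℝ := M + M / m

/-- The constant `A` of the data extracted from a Hajłasz pair. -/
def dataA (b δ m M L : ℝ) : ℝ := b ^ (-(1 / m)) * oscFactor δ (M * L) 1

section Extraction

variable [MetricSpace X] [MeasurableSpace X] [BorelSpace X] {μ : Measure X}
  {b δ m M L : ℝ} {Q p s : X → ℝ} {E : Set X} {u : X → ℝ} {g : X → ℝ≥0∞}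

/-- In every small ball inside `E` there is a point outside a given null set where a function with
modular at most one is controlled by the lower bound on the measure. -/
lemma Admissible.exists_mem_ball_le (h : Admissible b δ m M L μ Q p s) (hb : 0 < b) (hb1 : b ≤ 1)
    (hm : 0 < m) (hM : 0 < M) (hL : 0 < L) {S : Set X} (hS : ∀ᵐ x ∂μ.restrict E, x ∈ S)
    {G : X → ℝ} (hG : ∀ x, 0 ≤ G x)
    (hGm : AEMeasurable G (μ.restrict E))
    (hint : ∫⁻ x in E, ENNReal.ofReal (G x ^ p x) ∂μ ≤ 1) {x : X} {r : ℝ} (hr : 0 < r)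
    (hrδ : r ≤ δ) (hball : Metric.ball x r ⊆ E) :
    ∃ y ∈ S, y ∈ Metric.ball x r ∧ G y ≤ dataA b δ m M L * r ^ (-(Q x / p x)) := by
  obtain ⟨hμ0, hμt⟩ := h.metricMeasure x r hr
  have : IsFiniteMeasure (μ.restrict (Metric.ball x r)) := ⟨by simpa using hμt⟩
  have hFm : AEMeasurable (fun x => ENNReal.ofReal (G x ^ p x))
      (μ.restrict (Metric.ball x r)) :=
    ((hGm.mono_measure (Measure.restrict_mono_set _ hball)).pow
      h.integrability.measurable.aemeasurable).ennreal_ofReal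
  have hnull : μ.restrict (Metric.ball x r) {y | ¬ (y ∈ S ∧ y ∈ Metric.ball x r)} = 0 := by
    rw [← ae_iff]
    filter_upwards [ae_restrict_of_ae_restrict_of_subset hball hS,
      ae_restrict_mem measurableSet_ball] with y h1 h2 using ⟨h1, h2⟩
  -- A function is at most its mean at some point outside any given null set.
  obtain ⟨y, hy, hle⟩ := exists_notMem_null_le_laverage
    (by rw [Ne, Measure.restrict_eq_zero]; exact hμ0.ne') hFm hnull
  simp only [mem_ofPred_eq, not_not] at hy
  refine ⟨y, hy.1, hy.2, ?_⟩
  have hpy : 0 < p y := h.integrability.pos y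
  have hbr : 0 < b * r ^ Q x := by positivity
  have h1 : G y ^ p y ≤ (b * r ^ Q x)⁻¹ := by
    have h2 : ENNReal.ofReal (G y ^ p y) ≤ ENNReal.ofReal (b * r ^ Q x)⁻¹ := by
      rw [ENNReal.ofReal_inv_of_pos hbr]
      refine hle.trans ?_
      rw [setLAverage_eq, div_eq_mul_inv]
      refine (mul_le_mul' ((lintegral_mono_set hball).trans hint)
        (ENNReal.inv_le_inv.2 (h.lowerAhlfors x r hr hrδ))).trans ?_
      rw [one_mul]
    exact (ENNReal.ofReal_le_ofReal_iff (by positivity)).1 h2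
  have h3 : G y ≤ (b * r ^ Q x)⁻¹ ^ (p y)⁻¹ :=
    (Real.le_rpow_inv_iff_of_pos (hG y) (by positivity) hpy).2 h1
  -- The measure bound is taken at the centre, so `Q x` stays frozen and only the modulus of `1/p`
  -- matters.
  have hlog : HasLogModulus (M * L) fun y => -(Q x / p y) := by
    refine HasLogModulus.neg (f := fun y => Q x / p y) ?_
    refine h.integrability.hasLogModulus_one_div.of_le_mul hM.le fun z w => ?_
    rw [show Q x / p z - Q x / p w = Q x * (1 / p z - 1 / p w) by ring, abs_mul,
      abs_of_pos (h.dimension.pos x)]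
    gcongr
    exact h.dimension.le' h.metricMeasure x
  calc G y ≤ (b * r ^ Q x)⁻¹ ^ (p y)⁻¹ := h3
    _ = b ^ (-(1 / p y)) * r ^ (-(Q x / p y)) := by
        rw [Real.inv_rpow hbr.le, Real.mul_rpow hb.le (by positivity), mul_inv,
          Real.rpow_neg hb.le, Real.rpow_neg hr.le, ← Real.rpow_mul hr.le, one_div,
          div_eq_mul_inv]
    _ ≤ b ^ (-(1 / m)) * (oscFactor δ (M * L) 1 * r ^ (-(Q x / p x))) := by
        gcongr ?_ * ?_
        · refine Real.rpow_le_rpow_of_exponent_ge hb hb1 (neg_le_neg ?_)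
          exact one_div_le_one_div_of_le hm (h.integrability.le h.metricMeasure y)
        · refine hlog.rpow_le (by positivity) zero_le_one hr hrδ ?_
          rw [one_mul]
          exact (Metric.mem_ball.1 hy.2).le
    _ = _ := by
        rw [dataA]
        ring

/-- The pointwise data of a Hajłasz pair on a set `S` of full measure, for every normalisation
`l > ‖g‖`. -/
lemma Admissible.exists_gradientData (h : Admissible b δ m M L μ Q p s) (hδ : 0 < δ) (hb : 0 < b)
    (hb1 : b ≤ 1) (hm : 0 < m) (hM : 0 < M) (hL : 0 < L) (hE : MeasurableSet E)
    (hug : IsHajlaszPair μ E s p u g) :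
    ∃ S : Set X, (∀ᵐ x ∂μ.restrict E, x ∈ S) ∧
      ∀ l : ℝ, 0 < l → luxNorm (μ.restrict E) p g < ENNReal.ofReal l →
        GradientData δ (dataΛ m M L) (dataR m M) (dataA b δ m M L) E S s (fun x => Q x / p x)
          (fun x => u x / l) (fun x => (g x).toReal / l) ∧
        ∫⁻ x in E, ENNReal.ofReal (((g x).toReal / l) ^ p x) ∂μ ≤ 1 := by
  obtain ⟨-, ⟨N, hN, hgrad⟩, hgm, hgfin⟩ := hug
  have hμ := h.metricMeasure
  have hp0 := h.integrability.pos
  have hpm := h.integrability.le hμ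
  -- Points with `g = ∞` are discarded, so passing to real values loses nothing in the gradient
  -- inequality. The set does not depend on `l`. Taking `l` strictly above the norm avoids asking
  -- whether the infimum is attained and covers norm zero.
  have hS : ∀ᵐ x ∂μ.restrict E, x ∈ {x | x ∈ E ∧ x ∉ N ∧ g x ≠ ∞} := by
    have h1 : ∀ᵐ x ∂μ.restrict E, g x ^ p x < ∞ :=
      ae_lt_top' (hgm.pow h.integrability.measurable.aemeasurable) hgfin.ne
    have h2 : ∀ᵐ x ∂μ.restrict E, x ∉ N :=
      ae_restrict_of_ae (measure_eq_zero_iff_ae_notMem.1 hN)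
    filter_upwards [h1, h2, ae_restrict_mem hE] with x hx1 hx2 hx3
    refine ⟨hx3, hx2, fun htop => ?_⟩
    rw [htop, ENNReal.top_rpow_of_pos (hp0 x)] at hx1
    exact lt_irrefl _ hx1
  refine ⟨{x | x ∈ E ∧ x ∉ N ∧ g x ≠ ∞}, hS, ?_⟩
  intro l hl hlt
  have hint : ∫⁻ x in E, ENNReal.ofReal (((g x).toReal / l) ^ p x) ∂μ ≤ 1 := by
    refine le_trans (lintegral_mono fun x => ?_)
      (modular_div_le_one_of_luxNorm_lt (fun x => (hp0 x).le) hlt)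
    dsimp only
    rw [← ENNReal.ofReal_rpow_of_nonneg (by positivity) (hp0 x).le, ENNReal.ofReal_div_of_pos hl]
    exact ENNReal.rpow_le_rpow (ENNReal.div_le_div_right ENNReal.ofReal_toReal_le _) (hp0 x).le
  refine ⟨?_, hint⟩
  have hGm : AEMeasurable (fun x => (g x).toReal / l) (μ.restrict E) :=
    hgm.ennreal_toReal.div_const l
  have hdiv0 : 0 ≤ M / m := by positivity
  exact
    { δ_pos := hδ
      Λ_nonneg := by unfold dataΛ; positivity
      R_nonneg := by unfold dataR; positivity
      A_nonneg := by unfold dataA oscFactor; positivity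
      s_nonneg := fun x => (h.smoothness.pos x).le
      s_le := fun x => by
        have := h.smoothness.le' hμ x
        unfold dataR
        linarith
      q_pos := fun x => div_pos (h.dimension.pos x) (hp0 x)
      q_le := fun x => by
        have : Q x / p x ≤ M / m := div_le_div₀ hM.le (h.dimension.le' hμ x) hm (hpm x)
        unfold dataR
        linarith
      s_log := (h.smoothness.hasLogModulus hμ).mono (by
        unfold dataΛ
        have : 0 ≤ M * L + 1 / m * (M ^ 2 * L) := by positivity
        linarith)
      q_log := (IsLogHolderExponent.hasLogModulus_div hm hM.le hμ h.integrability
        h.dimension).mono (by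
          unfold dataΛ
          have : 0 ≤ M ^ 2 * L := by positivity
          linarith)
      G_nonneg := fun x => by positivity
      grad := by
        rintro x ⟨hxE, hxN, hxg⟩ y ⟨hyE, hyN, hyg⟩
        have h1 := hgrad x ⟨hxE, hxN⟩ y ⟨hyE, hyN⟩
        rw [← ENNReal.ofReal_toReal hxg, ← ENNReal.ofReal_toReal hyg,
          ← ENNReal.ofReal_mul (by positivity), ← ENNReal.ofReal_mul (by positivity),
          ← ENNReal.ofReal_add (by positivity) (by positivity),
          ENNReal.ofReal_le_ofReal_iff (by positivity)] at h1
        rw [← sub_div, abs_div, abs_of_pos hl, ← mul_div_assoc, ← mul_div_assoc, ← add_div]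
        gcongr
      pick := fun x r hr hrδ hball =>
        h.exists_mem_ball_le hb hb1 hm hM hL hS (fun x => by positivity) hGm hint hr hrδ
          hball }

end Extraction

/-! ### Integral estimates, means, and continuous extension. -/

lemma max_rpow_le_add {a c p : ℝ} (ha : 0 ≤ a) (hc : 0 ≤ c) : max a c ^ p ≤ a ^ p + c ^ p := by
  rcases le_total a c with h | h
  · rw [max_eq_right h]
    exact le_add_of_nonneg_left (by positivity)
  · rw [max_eq_left h]
    exact le_add_of_nonneg_right (by positivity)

lemma setLIntegral_le_of_ae_le_add_mul [MeasurableSpace X] {μ : Measure X} {B : Set X}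
    (hB : μ B ≠ ∞) {F : X → ℝ≥0∞} {H : X → ℝ} {ξ η : ℝ} (hξ : 0 ≤ ξ) (hη : 0 ≤ η)
    (hH : ∀ x, 0 ≤ H x) (hle : ∀ᵐ x ∂μ.restrict B, F x ≤ ENNReal.ofReal (ξ + η * H x))
    (hint : ∫⁻ x in B, ENNReal.ofReal (H x) ∂μ ≤ 1) :
    ∫⁻ x in B, F x ∂μ ≤ ENNReal.ofReal (ξ * μ.real B + η) := by
  calc ∫⁻ x in B, F x ∂μ
      ≤ ∫⁻ x in B, (ENNReal.ofReal ξ + ENNReal.ofReal η * ENNReal.ofReal (H x)) ∂μ := by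
        refine lintegral_mono_ae ?_
        filter_upwards [hle] with x hx
        refine hx.trans (le_of_eq ?_)
        rw [ENNReal.ofReal_add hξ (mul_nonneg hη (hH x)), ENNReal.ofReal_mul hη]
    _ = ENNReal.ofReal ξ * μ B +
        ENNReal.ofReal η * ∫⁻ x in B, ENNReal.ofReal (H x) ∂μ := by
        rw [lintegral_add_left measurable_const, lintegral_const_mul' _ _ ENNReal.ofReal_ne_top,
          lintegral_const, Measure.restrict_apply_univ]
    _ ≤ ENNReal.ofReal ξ * ENNReal.ofReal (μ.real B) + ENNReal.ofReal η * 1 := by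
        gcongr
        rw [ofReal_measureReal hB]
    _ = ENNReal.ofReal (ξ * μ.real B + η) := by
        rw [mul_one, ← ENNReal.ofReal_mul hξ, ← ENNReal.ofReal_add (by positivity) hη]

/-- Exponential integrability around some constant implies exponential integrability around the
mean value. -/
lemma setLAverage_exp_abs_sub_average_le [MeasurableSpace X] {μ : Measure X} {B : Set X}
    (hB0 : μ B ≠ 0) (hB : μ B ≠ ∞) {v : X → ℝ} (hv : AEMeasurable v (μ.restrict B)) {c k T : ℝ}
    (hk : 0 < k) (hT : 0 ≤ T)
    (hint : ∫⁻ x in B, ENNReal.ofReal (Real.exp (k * |v x - c|)) ∂μ ≤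
      ENNReal.ofReal (T * μ.real B)) :
    IntegrableOn v B μ ∧
      ⨍⁻ x in B, ENNReal.ofReal (Real.exp (k * |v x - ⨍ y in B, v y ∂μ|)) ∂μ ≤
        ENNReal.ofReal (T * Real.exp T) := by
  have hfin : IsFiniteMeasure (μ.restrict B) := ⟨by simpa using hB.lt_top⟩
  have hBr : 0 < μ.real B := ENNReal.toReal_pos hB0 hB
  have hem : AEStronglyMeasurable (fun x => Real.exp (k * |v x - c|)) (μ.restrict B) := by
    refine (Real.continuous_exp.measurable.comp_aemeasurable ?_).aestronglyMeasurable
    exact (measurable_norm.comp_aemeasurable (hv.sub_const c)).const_mul k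
  have hei : Integrable (fun x => Real.exp (k * |v x - c|)) (μ.restrict B) := by
    refine ⟨hem, ?_⟩
    rw [hasFiniteIntegral_iff_ofReal (Eventually.of_forall fun x => (Real.exp_pos _).le)]
    exact hint.trans_lt ENNReal.ofReal_lt_top
  have hle : ∀ x, |v x - c| ≤ k⁻¹ * Real.exp (k * |v x - c|) := by
    intro x
    rw [inv_mul_eq_div, le_div_iff₀ hk, mul_comm]
    linarith [Real.add_one_le_exp (k * |v x - c|)]
  have hdi : Integrable (fun x => v x - c) (μ.restrict B) :=
    (hei.const_mul k⁻¹).mono' (hv.sub_const c).aestronglyMeasurable (Eventually.of_forall hle)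
  have hvi : IntegrableOn v B μ := by
    have := hdi.add (integrable_const c)
    refine this.congr (Eventually.of_forall fun x => ?_)
    simp
  refine ⟨hvi, ?_⟩
  set a := ⨍ y in B, v y ∂μ with ha
  have hei_le : ∫ x in B, Real.exp (k * |v x - c|) ∂μ ≤ T * μ.real B := by
    rw [integral_eq_lintegral_of_nonneg_ae (Eventually.of_forall fun x => (Real.exp_pos _).le) hem]
    exact ENNReal.toReal_le_of_le_ofReal (by positivity) hint
  -- The inequality `k |v - c| ≤ exp (k |v - c|)`, averaged over `B`, bounds the distance from `c`
  -- to the mean. Replacing `c` by the mean then costs a factor `exp T`.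
  have hca : k * |c - a| ≤ T := by
    have h1 : a - c = (μ.real B)⁻¹ * ∫ x in B, (v x - c) ∂μ := by
      rw [integral_sub hvi (integrable_const c), ha, setAverage_eq, smul_eq_mul,
        setIntegral_const, smul_eq_mul]
      field_simp
    have h2 : |∫ x in B, (v x - c) ∂μ| ≤ k⁻¹ * (T * μ.real B) := by
      calc |∫ x in B, (v x - c) ∂μ| ≤ ∫ x in B, |v x - c| ∂μ := abs_integral_le_integral_abs
        _ ≤ ∫ x in B, k⁻¹ * Real.exp (k * |v x - c|) ∂μ :=
          integral_mono hdi.abs (hei.const_mul k⁻¹) hle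
        _ ≤ _ := by
          rw [integral_const_mul]
          gcongr
    rw [abs_sub_comm, h1, abs_mul, abs_of_pos (inv_pos.2 hBr)]
    calc k * ((μ.real B)⁻¹ * |∫ x in B, (v x - c) ∂μ|)
        ≤ k * ((μ.real B)⁻¹ * (k⁻¹ * (T * μ.real B))) := by gcongr
      _ = T := by field_simp
  rw [setLAverage_eq]
  refine ENNReal.div_le_of_le_mul ?_
  calc ∫⁻ x in B, ENNReal.ofReal (Real.exp (k * |v x - a|)) ∂μ
      ≤ ∫⁻ x in B, ENNReal.ofReal (Real.exp T) *
          ENNReal.ofReal (Real.exp (k * |v x - c|)) ∂μ := by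
        refine lintegral_mono fun x => ?_
        rw [← ENNReal.ofReal_mul (Real.exp_pos _).le, ← Real.exp_add]
        refine ENNReal.ofReal_le_ofReal (Real.exp_le_exp.2 ?_)
        have := mul_le_mul_of_nonneg_left (abs_sub_le (v x) c a) hk.le
        linarith
    _ ≤ ENNReal.ofReal (Real.exp T) * ENNReal.ofReal (T * μ.real B) := by
        rw [lintegral_const_mul' _ _ ENNReal.ofReal_ne_top]
        gcongr
    _ = ENNReal.ofReal (T * Real.exp T) * μ B := by
        rw [← ofReal_measureReal hB, ← ENNReal.ofReal_mul (Real.exp_pos _).le,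
          ← ENNReal.ofReal_mul (by positivity)]
        congr 1
        ring

/-- A function satisfying a Hölder condition with continuous variable exponent on a set `T` extends
to a continuous function on any set in which `T` is dense, with the same Hölder condition. -/
lemma exists_continuousOn_extension [MetricSpace X] {T U : Set X} (hTU : U ⊆ closure T)
    {u α : X → ℝ} {C a₀ : ℝ} (hC : 0 ≤ C) (ha₀ : 0 < a₀) (hα : Continuous α)
    (hα₀ : ∀ x, a₀ ≤ α x) (hu : ∀ x ∈ T, ∀ y ∈ T, |u x - u y| ≤ C * dist x y ^ α x) :
    ∃ v : X → ℝ, ContinuousOn v U ∧ (∀ x ∈ T, x ∈ U → v x = u x) ∧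
      ∀ x ∈ U, ∀ y ∈ U, |v x - v y| ≤ C * dist x y ^ α x := by
  have hlim : ∀ x ∈ U, ∃ l, Tendsto u (𝓝[T] x) (𝓝 l) := by
    intro x hx
    have hne : (𝓝[T] x).NeBot := mem_closure_iff_nhdsWithin_neBot.1 (hTU hx)
    refine cauchy_map_iff_exists_tendsto.1 (Metric.cauchy_iff.2 ⟨hne.map u, fun ε hε => ?_⟩)
    have h0 : Tendsto (fun r : ℝ => C * (2 * r) ^ a₀) (𝓝[>] 0) (𝓝 0) := by
      have : Continuous fun r : ℝ => C * (2 * r) ^ a₀ :=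
        continuous_const.mul ((continuous_const.mul continuous_id).rpow_const
          fun _ => Or.inr ha₀.le)
      have h1 := this.tendsto 0
      rw [mul_zero, Real.zero_rpow ha₀.ne', mul_zero] at h1
      exact h1.mono_left nhdsWithin_le_nhds
    obtain ⟨r, hrε, hr0, hr1⟩ := ((h0.eventually (gt_mem_nhds hε)).and
      (Ioo_mem_nhdsGT (show (0 : ℝ) < 1 / 2 by norm_num))).exists
    refine ⟨u '' (T ∩ Metric.ball x r), image_mem_map
      (inter_mem self_mem_nhdsWithin (mem_nhdsWithin_of_mem_nhds (Metric.ball_mem_nhds x hr0))), ?_⟩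
    rintro _ ⟨y, ⟨hyT, hyx⟩, rfl⟩ _ ⟨z, ⟨hzT, hzx⟩, rfl⟩
    have hd : dist y z ≤ 2 * r := by
      have := dist_triangle_right y z x
      have := Metric.mem_ball.1 hyx
      have := Metric.mem_ball.1 hzx
      linarith
    -- For lengths at most one the variable exponent may be lowered to `a₀`, giving a uniform Cauchy
    -- estimate.
    have h2r : 2 * r ≤ 1 := by linarith
    calc dist (u y) (u z) ≤ C * dist y z ^ α y := hu y hyT z hzT
      _ ≤ C * (2 * r) ^ α y := by
        gcongr
        exact ha₀.le.trans (hα₀ y)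
      _ ≤ C * (2 * r) ^ a₀ := by
        refine mul_le_mul_of_nonneg_left ?_ hC
        exact Real.rpow_le_rpow_of_exponent_ge (by linarith) h2r (hα₀ y)
      _ < ε := hrε
  choose! v hv using hlim
  have hvu : ∀ x ∈ T, x ∈ U → v x = u x := by
    intro x hxT hxU
    have h1 : Tendsto u (pure x) (𝓝 (v x)) := (hv x hxU).mono_left (pure_le_nhdsWithin hxT)
    exact tendsto_nhds_unique h1 (tendsto_pure_nhds u x)
  have hholder : ∀ x ∈ U, ∀ y ∈ U, |v x - v y| ≤ C * dist x y ^ α x := by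
    intro x hx y hy
    have hnx : (𝓝[T] x).NeBot := mem_closure_iff_nhdsWithin_neBot.1 (hTU hx)
    have hny : (𝓝[T] y).NeBot := mem_closure_iff_nhdsWithin_neBot.1 (hTU hy)
    have h1 : Tendsto (fun w : X × X => |u w.1 - u w.2|) (𝓝[T] x ×ˢ 𝓝[T] y)
        (𝓝 |v x - v y|) :=
      (((hv x hx).comp tendsto_fst).sub ((hv y hy).comp tendsto_snd)).abs
    have h2 : Continuous fun w : X × X => C * dist w.1 w.2 ^ α w.1 := by
      refine continuous_const.mul (Continuous.rpow (by fun_prop) (by fun_prop) fun w => ?_)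
      exact Or.inr (ha₀.trans_le (hα₀ _))
    have h3 : Tendsto (fun w : X × X => C * dist w.1 w.2 ^ α w.1) (𝓝[T] x ×ˢ 𝓝[T] y)
        (𝓝 (C * dist x y ^ α x)) := by
      refine (h2.tendsto (x, y)).mono_left ?_
      rw [nhds_prod_eq]
      exact prod_mono nhdsWithin_le_nhds nhdsWithin_le_nhds
    refine le_of_tendsto_of_tendsto h1 h3 ?_
    filter_upwards [prod_mem_prod self_mem_nhdsWithin self_mem_nhdsWithin] with w hw
    exact hu _ hw.1 _ hw.2
  refine ⟨v, fun x hx => ?_, hvu, hholder⟩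
  rw [ContinuousWithinAt, tendsto_iff_dist_tendsto_zero]
  have h4 : Tendsto (fun y => C * dist x y ^ α x) (𝓝[U] x) (𝓝 0) := by
    have hc : Continuous fun y => C * dist x y ^ α x :=
      continuous_const.mul ((by fun_prop : Continuous fun y => dist x y).rpow_const
        fun _ => Or.inr (ha₀.le.trans (hα₀ x)))
    have := hc.tendsto x
    rw [dist_self, Real.zero_rpow (ha₀.trans_le (hα₀ x)).ne', mul_zero] at this
    exact this.mono_left nhdsWithin_le_nhds
  refine squeeze_zero' (Eventually.of_forall fun _ => dist_nonneg) ?_ h4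
  filter_upwards [self_mem_nhdsWithin] with y hy
  rw [Real.dist_eq, abs_sub_comm]
  exact hholder x hx y hy

/-- A bounded oscillation on a set of finite measure bounds the deviation from the mean. -/
lemma integrableOn_and_eLpNorm_sub_average_le [MeasurableSpace X] {μ : Measure X} {B S : Set X}
    (hBm : MeasurableSet B) (hB0 : μ B ≠ 0) (hB : μ B ≠ ∞) {v : X → ℝ}
    (hv : AEMeasurable v (μ.restrict B)) (hS : ∀ᵐ x ∂μ.restrict B, x ∈ S) {C : ℝ}
    (hC : ∀ x ∈ B, x ∈ S → ∀ y ∈ B, y ∈ S → |v x - v y| ≤ C) :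
    IntegrableOn v B μ ∧
      eLpNorm (fun x => v x - ⨍ y in B, v y ∂μ) ∞ (μ.restrict B) ≤ ENNReal.ofReal C := by
  have hSB : ∀ᵐ x ∂μ.restrict B, x ∈ B ∧ x ∈ S := (ae_restrict_mem hBm).and hS
  have hfin : IsFiniteMeasure (μ.restrict B) := ⟨by simpa using hB.lt_top⟩
  have hne : (ae (μ.restrict B)).NeBot := ae_neBot.2 (by rwa [Ne, Measure.restrict_eq_zero])
  obtain ⟨z, hz⟩ := hSB.exists
  have hvi : IntegrableOn v B μ := by
    refine Integrable.mono' (integrable_const (|v z| + C)) hv.aestronglyMeasurable ?_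
    filter_upwards [hSB] with x hx
    have h1 := hC x hx.1 hx.2 z hz.1 hz.2
    have h2 := abs_sub_abs_le_abs_sub (v x) (v z)
    rw [Real.norm_eq_abs]
    linarith
  refine ⟨hvi, ?_⟩
  rw [eLpNorm_exponent_top]
  refine eLpNormEssSup_le_of_ae_bound ?_
  filter_upwards [hSB] with x hx
  -- Almost all values lie in the closed interval of radius `C` about `v x`, so by convexity the
  -- mean does too.
  have := (convex_closedBall (v x) C).set_average_mem Metric.isClosed_closedBall hB0 hB
    (f := v) (by
      filter_upwards [hSB] with y hy
      rw [Metric.mem_closedBall, Real.dist_eq, abs_sub_comm]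
      exact hC x hx.1 hx.2 y hy.1 hy.2) hvi
  rwa [Metric.mem_closedBall, Real.dist_eq, abs_sub_comm] at this

lemma le_mul_of_forall_gt_le_mul {a c n : ℝ} (h : ∀ l, n < l → c ≤ a * l) : c ≤ a * n := by
  have h1 : Tendsto (fun l : ℝ => a * l) (𝓝[>] n) (𝓝 (a * n)) :=
    ((continuous_const.mul continuous_id).tendsto n).mono_left nhdsWithin_le_nhds
  exact ge_of_tendsto h1 (by filter_upwards [self_mem_nhdsWithin] with l hl using h l hl)

lemma ball_sub_one_mul_subset [MetricSpace X] {x x₀ : X} {σ r₀ : ℝ}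
    (hx : x ∈ Metric.ball x₀ r₀) :
    Metric.ball x ((σ - 1) * r₀) ⊆ Metric.ball x₀ (σ * r₀) :=
  Metric.ball_subset_ball' (by linarith [Metric.mem_ball.1 hx])

/-! ### Comparison of scales and algebra of the Sobolev conjugate. -/

/-- The factor relating `((σ-1) r₀)^{∓Q(x)}` to `r₀^{∓Q(x₀)}` for `x` in `B(x₀,r₀)`. -/
def scaleConst (σ δ M L : ℝ) : ℝ :=
  oscFactor δ (M ^ 2 * L) (σ - 1)⁻¹ * ((σ - 1)⁻¹ + σ) ^ M

/-- The factor required to pass from the pointwise estimate to the Sobolev inequality. -/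
def sobolevFactor (b σ δ m M L θ : ℝ) : ℝ :=
  ((b ^ (M ^ 2 / θ / m))⁻¹ * (1 / b + scaleConst σ δ M L)) ^ m⁻¹

/-- The bound for the exponential integral in the critical case. -/
def expBound (b σ δ m M L : ℝ) : ℝ := 4 ^ m * (1 + scaleConst σ δ M L / b)

section Scale

variable [MetricSpace X] {σ δ M L : ℝ} {Q : X → ℝ}

lemma scaleConst_pos (hσ : 1 < σ) : 0 < scaleConst σ δ M L := by
  have : 0 < σ - 1 := sub_pos.2 hσ
  unfold scaleConst oscFactor
  positivity

lemma rpow_neg_le_scaleConst (hσ : 1 < σ) (hL : 0 ≤ L)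
    (hQ : HasLogModulus (M ^ 2 * L) Q) (hQ0 : ∀ x, 0 ≤ Q x) (hQM : ∀ x, Q x ≤ M) {x x₀ : X}
    {r₀ : ℝ} (hr₀ : 0 < r₀) (hr : (σ - 1) * r₀ ≤ δ) (hx : dist x x₀ ≤ r₀) :
    ((σ - 1) * r₀) ^ (-Q x) ≤ scaleConst σ δ M L * r₀ ^ (-Q x₀) := by
  have hσ' : 0 < σ - 1 := sub_pos.2 hσ
  have h1 : ((σ - 1) * r₀) ^ (-Q x) ≤
      oscFactor δ (M ^ 2 * L) (σ - 1)⁻¹ * ((σ - 1) * r₀) ^ (-Q x₀) :=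
    hQ.neg.rpow_le (by positivity) (by positivity) (by positivity) hr (by field_simp; exact hx)
  refine h1.trans ?_
  rw [scaleConst, Real.mul_rpow hσ'.le hr₀.le, mul_assoc]
  -- Since `σ - 1` may lie on either side of one, the base is enlarged to one that exceeds 1 and
  -- dominates both `σ - 1` and its inverse.
  have h2 : (σ - 1) ^ (-Q x₀) ≤ ((σ - 1)⁻¹ + σ) ^ M := by
    rw [Real.rpow_neg hσ'.le, ← Real.inv_rpow hσ'.le]
    have h3 : 0 < (σ - 1)⁻¹ := by positivity
    refine (Real.rpow_le_rpow h3.le (by linarith : (σ - 1)⁻¹ ≤ (σ - 1)⁻¹ + σ) (hQ0 x₀)).trans ?_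
    exact Real.rpow_le_rpow_of_exponent_le (by linarith) (hQM x₀)
  have h4 : 0 ≤ oscFactor δ (M ^ 2 * L) (σ - 1)⁻¹ := (Real.exp_pos _).le
  gcongr

lemma rpow_le_scaleConst (hσ : 1 < σ) (hL : 0 ≤ L)
    (hQ : HasLogModulus (M ^ 2 * L) Q) (hQ0 : ∀ x, 0 ≤ Q x) (hQM : ∀ x, Q x ≤ M) {x x₀ : X}
    {r₀ : ℝ} (hr₀ : 0 < r₀) (hr : (σ - 1) * r₀ ≤ δ) (hx : dist x x₀ ≤ r₀) :
    ((σ - 1) * r₀) ^ Q x ≤ scaleConst σ δ M L * r₀ ^ Q x₀ := by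
  have hσ' : 0 < σ - 1 := sub_pos.2 hσ
  have h1 : ((σ - 1) * r₀) ^ Q x ≤
      oscFactor δ (M ^ 2 * L) (σ - 1)⁻¹ * ((σ - 1) * r₀) ^ Q x₀ :=
    hQ.rpow_le (by positivity) (by positivity) (by positivity) hr (by field_simp; exact hx)
  refine h1.trans ?_
  rw [scaleConst, Real.mul_rpow hσ'.le hr₀.le, mul_assoc]
  have h2 : (σ - 1) ^ Q x₀ ≤ ((σ - 1)⁻¹ + σ) ^ M := by
    have h3 : 0 < (σ - 1)⁻¹ := by positivity
    refine (Real.rpow_le_rpow hσ'.le (by linarith : σ - 1 ≤ (σ - 1)⁻¹ + σ) (hQ0 x₀)).trans ?_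
    exact Real.rpow_le_rpow_of_exponent_le (by linarith) (hQM x₀)
  have h4 : 0 ≤ oscFactor δ (M ^ 2 * L) (σ - 1)⁻¹ := (Real.exp_pos _).le
  gcongr

end Scale

section SobolevConj

variable {Q p s : X → ℝ} {x : X} {m M θ : ℝ}

lemma le_sobolevConj (hs : 0 ≤ s x) (hp : 0 < p x) (hθ : 0 < θ) (h : s x * p x + θ ≤ Q x) :
    p x ≤ sobolevConj Q p s x := by
  have hd : 0 < Q x - s x * p x := by linarith
  rw [sobolevConj, le_div_iff₀ hd, mul_comm]
  gcongr
  linarith [mul_nonneg hs hp.le]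

lemma sobolevConj_le (hp : 0 < p x) (hpM : p x ≤ M) (hQM : Q x ≤ M) (hθ : 0 < θ)
    (h : s x * p x + θ ≤ Q x) : sobolevConj Q p s x ≤ M ^ 2 / θ := by
  rw [sobolevConj, sq]
  have : 0 < M := hp.trans_le hpM
  gcongr
  linarith

/-- This identity dictates the conjugate exponent: it turns `(t^{s-q})^γ` into `t^{-Q}`, which is
comparable with `G^p`. -/
lemma mul_sobolevConj (hp : 0 < p x) (hθ : 0 < θ) (h : s x * p x + θ ≤ Q x) :
    (s x - Q x / p x) * sobolevConj Q p s x = -Q x := by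
  have hd : Q x - s x * p x ≠ 0 := by linarith
  rw [sobolevConj]
  field_simp
  ring

end SobolevConj

/-! ### Integrating the subcritical and critical estimates. -/

section Main

variable [MetricSpace X] [MeasurableSpace X] {μ : Measure X} {b σ δ m M L : ℝ} {Q p s : X → ℝ}

/-- The pointwise subcritical estimate raised to the power `γ(x)` and normalised. -/
lemma div_rpow_sobolevConj_le {θ a γ₀ γ P CS t N V d G ρ p' Q' q' α r : ℝ}
    (hm : 0 < m) (hb : 0 < b) (hb1 : b ≤ 1) (ha : b ≤ a) (hP : 1 ≤ P) (hV : 0 < V)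
    (hN : N = (b ^ (M ^ 2 / θ / m))⁻¹ * (1 / b + V)) (hCS : P * N ^ m⁻¹ ≤ CS)
    (hγ₀ : m ≤ γ₀) (hγγ₀ : γ₀ ≤ γ) (hγ : γ ≤ M ^ 2 / θ)
    (ht : 0 < t) (hG : 0 ≤ G) (hρ : 0 < ρ)
    (htG : t ^ (-q') = max G (ρ ^ (-q')))
    (hqp : q' * p' = Q') (hαγ : α * γ = -Q') (hd0 : 0 ≤ d) (hd : d ≤ P * t ^ α)
    (hρr : ρ ^ (-Q') ≤ V * r) :
    (d / (CS * a ^ (1 / γ₀))) ^ γ ≤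
      ((1 / b + V) * a)⁻¹ * (V * r) + ((1 / b + V) * a)⁻¹ * G ^ p' := by
  have ha0 : 0 < a := hb.trans_le ha
  have hγ0' : 0 < γ₀ := hm.trans_le hγ₀
  have hγ0 : 0 < γ := hγ0'.trans_le hγγ₀
  set e := M ^ 2 / θ / m with he
  have hγe : γ / γ₀ ≤ e := by
    rw [he]
    exact div_le_div₀ (hγ0.le.trans hγ) hγ hm hγ₀
  have hbe0 : 0 < b ^ e := by positivity
  have hbe1 : b ^ e ≤ 1 := Real.rpow_le_one hb.le hb1 (by
    have : 0 < γ / γ₀ := by positivity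
    linarith)
  -- Here `a` stands for `μ(B₀) / r₀^{Q(x₀)} ≥ b` and `γ/γ₀` lies between 1 and `e`. The factor
  -- `b^e` is needed only when `a < 1`.
  have hae : b ^ e * a ≤ a ^ (γ / γ₀) := by
    rcases le_total 1 a with h1 | h1
    · calc b ^ e * a ≤ 1 * a := by gcongr
        _ = a ^ (1 : ℝ) := by rw [one_mul, Real.rpow_one]
        _ ≤ a ^ (γ / γ₀) :=
          Real.rpow_le_rpow_of_exponent_le h1 ((one_le_div hγ0').2 hγγ₀)
    · calc b ^ e * a ≤ b ^ e * 1 := by gcongr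
        _ ≤ a ^ e := by
          rw [mul_one]
          exact Real.rpow_le_rpow hb.le ha (by
            have : 0 < γ / γ₀ := by positivity
            linarith)
        _ ≤ a ^ (γ / γ₀) := Real.rpow_le_rpow_of_exponent_ge ha0 h1 hγe
  have hN1 : 1 ≤ N := by
    rw [hN]
    have h1 : 1 ≤ (b ^ e)⁻¹ := (one_le_inv₀ hbe0).2 hbe1
    have h2 : 1 ≤ 1 / b + V := by
      have : 1 ≤ 1 / b := (one_le_div hb).2 hb1
      linarith
    nlinarith
  have hN0 : 0 < N := by linarith
  have hCS0 : 0 < CS := by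
    have : 0 < P * N ^ m⁻¹ := by positivity
    linarith
  -- Since `N ≥ 1` and `γ ≥ m`, the power `1/m` in the constant makes one choice work for every
  -- value of `γ`.
  have hCSγ : P ^ γ * N ≤ CS ^ γ := by
    calc P ^ γ * N ≤ P ^ γ * (N ^ m⁻¹) ^ γ := by
          gcongr
          rw [← Real.rpow_mul hN0.le]
          refine Real.self_le_rpow_of_one_le hN1 ?_
          rw [inv_mul_eq_div, one_le_div hm]
          linarith
      _ = (P * N ^ m⁻¹) ^ γ := (Real.mul_rpow (by linarith) (by positivity)).symm
      _ ≤ CS ^ γ := by gcongr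
  have hden : P ^ γ * ((1 / b + V) * a) ≤ (CS * a ^ (1 / γ₀)) ^ γ := by
    rw [Real.mul_rpow hCS0.le (by positivity), ← Real.rpow_mul ha0.le, one_div_mul_eq_div]
    calc P ^ γ * ((1 / b + V) * a) = P ^ γ * N * (b ^ e * a) := by
          rw [hN]
          field_simp
      _ ≤ CS ^ γ * a ^ (γ / γ₀) := by gcongr
  have htQ : (t ^ α) ^ γ ≤ G ^ p' + V * r := by
    rw [← Real.rpow_mul ht.le, hαγ, ← hqp, ← neg_mul, Real.rpow_mul ht.le, htG]
    refine (max_rpow_le_add hG (by positivity)).trans ?_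
    rw [← Real.rpow_mul hρ.le, neg_mul, hqp]
    gcongr
  have hPγ : 0 < P ^ γ := by positivity
  have hκ : 0 < (1 / b + V) * a := by positivity
  calc (d / (CS * a ^ (1 / γ₀))) ^ γ
      = d ^ γ / (CS * a ^ (1 / γ₀)) ^ γ := Real.div_rpow hd0 (by positivity) _
    _ ≤ (P * t ^ α) ^ γ / (P ^ γ * ((1 / b + V) * a)) := by gcongr
    _ = ((1 / b + V) * a)⁻¹ * (t ^ α) ^ γ := by
        rw [Real.mul_rpow (by linarith) (by positivity)]
        field_simp
    _ ≤ ((1 / b + V) * a)⁻¹ * (G ^ p' + V * r) := by gcongr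
    _ = _ := by ring

/-- The lower bound for the measure of a ball in terms of the real-valued measure. -/
lemma Admissible.le_measureReal_div (h : Admissible b δ m M L μ Q p s) {x : X} {r : ℝ}
    (hr : 0 < r) (hrδ : r ≤ δ) : b ≤ μ.real (Metric.ball x r) / r ^ Q x := by
  rw [le_div_iff₀ (by positivity)]
  exact (ENNReal.ofReal_le_iff_le_toReal (h.metricMeasure x r hr).2.ne).1
    (h.lowerAhlfors x r hr hrδ)

/-- For real functions the essential infimum is meaningful only under boundedness; the two-sided
bounds on the conjugate exponent supply it. -/
lemma essInf_sobolevConj_bounds {θ : ℝ} {B : Set X} (h : Admissible b δ m M L μ Q p s)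
    (hθ : 0 < θ) (hsp : ∀ x, s x * p x + θ ≤ Q x) (hB : μ B ≠ 0) :
    m ≤ essInf (sobolevConj Q p s) (μ.restrict B) ∧
      ∀ᵐ x ∂μ.restrict B, essInf (sobolevConj Q p s) (μ.restrict B) ≤ sobolevConj Q p s x := by
  have hμ := h.metricMeasure
  have hne : (ae (μ.restrict B)).NeBot := ae_neBot.2 (by rwa [Ne, Measure.restrict_eq_zero])
  have hlow : ∀ x, m ≤ sobolevConj Q p s x := fun x =>
    (h.integrability.le hμ x).trans
      (le_sobolevConj (h.smoothness.pos x).le (h.integrability.pos x) hθ (hsp x))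
  have hup : ∀ x, sobolevConj Q p s x ≤ M ^ 2 / θ := fun x =>
    sobolevConj_le (h.integrability.pos x) (h.integrability.le' hμ x) (h.dimension.le' hμ x)
      hθ (hsp x)
  refine ⟨?_, ae_essInf_le ⟨m, eventually_map.2 (Eventually.of_forall hlow)⟩⟩
  refine le_liminf_of_le ?_ (Eventually.of_forall hlow)
  exact IsBoundedUnder.isCoboundedUnder_ge
    ⟨M ^ 2 / θ, eventually_map.2 (Eventually.of_forall hup)⟩

variable [BorelSpace X]

lemma Admissible.luxNorm_sobolevConj_le (h : Admissible b δ m M L μ Q p s)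
    (hσ : 1 < σ) (hb : 0 < b) (hb1 : b ≤ 1) (hm : 0 < m) (hM : 0 < M) (hL : 0 < L) {θ : ℝ}
    (hθ : 0 < θ) (hsp : ∀ x, s x * p x + θ ≤ Q x) {x₀ : X} {r₀ : ℝ} (hr₀ : 0 < r₀)
    (hr₀δ : r₀ ≤ δ / σ) {CS : ℝ}
    (hCS : powerConst δ (dataΛ m M L) (dataR m M) (dataA b δ m M L) (σ - 1)⁻¹ (θ / M) *
      sobolevFactor b σ δ m M L θ ≤ CS)
    {u : X → ℝ} {G : X → ℝ} {S : Set X} {l : ℝ} (hl : 0 < l)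
    (hS : ∀ᵐ x ∂μ.restrict (Metric.ball x₀ (σ * r₀)), x ∈ S)
    (hdata : GradientData δ (dataΛ m M L) (dataR m M) (dataA b δ m M L)
      (Metric.ball x₀ (σ * r₀)) S s (fun x => Q x / p x) (fun x => u x / l) G)
    (hint : ∫⁻ x in Metric.ball x₀ (σ * r₀), ENNReal.ofReal (G x ^ p x) ∂μ ≤ 1) :
    ∃ c : ℝ, luxNorm (μ.restrict (Metric.ball x₀ r₀)) (sobolevConj Q p s)
        (fun x => ‖u x - c‖ₑ) ≤
      ENNReal.ofReal (CS * (μ.real (Metric.ball x₀ r₀) / r₀ ^ Q x₀) ^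
        (1 / essInf (sobolevConj Q p s) (μ.restrict (Metric.ball x₀ r₀))) * l) := by
  have hμ := h.metricMeasure
  have hσ' : 0 < σ - 1 := sub_pos.2 hσ
  have hσ0 : 0 < σ := by linarith
  have hσr : σ * r₀ ≤ δ := by
    rw [le_div_iff₀ hσ0] at hr₀δ
    linarith
  have hrδ : r₀ ≤ δ := by nlinarith
  set ρ := (σ - 1) * r₀ with hρdef
  have hρ : 0 < ρ := by positivity
  have hρδ : ρ ≤ δ := by
    rw [hρdef]
    linarith
  have hBE : Metric.ball x₀ r₀ ⊆ Metric.ball x₀ (σ * r₀) :=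
    Metric.ball_subset_ball (by nlinarith)
  obtain ⟨z, hzS, hzx, hGz⟩ := hdata.pick x₀ ρ hρ hρδ
    (ball_sub_one_mul_subset (Metric.mem_ball_self hr₀))
  -- The constant is the value of `u` at a good point for the ball of radius `ρ = (σ - 1) r₀` about
  -- `x₀`, the radius for which all balls centred in `B₀` stay inside `σ B₀`.
  refine ⟨u z, ?_⟩
  obtain ⟨hB0, hBt⟩ := hμ x₀ r₀ hr₀
  obtain ⟨hγ₀, hγγ₀⟩ := essInf_sobolevConj_bounds h hθ hsp hB0.ne'
  set γ₀ := essInf (sobolevConj Q p s) (μ.restrict (Metric.ball x₀ r₀)) with hγ₀def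
  set V := scaleConst σ δ M L with hVdef
  have hV : 0 < V := scaleConst_pos hσ
  set a := μ.real (Metric.ball x₀ r₀) / r₀ ^ Q x₀ with hadef
  have hba : b ≤ a := h.le_measureReal_div hr₀ hrδ
  have ha0 : 0 < a := hb.trans_le hba
  have hP := hdata.one_le_powerConst (K := (σ - 1)⁻¹) (a₀ := θ / M) (by positivity)
    (by positivity)
  set P := powerConst δ (dataΛ m M L) (dataR m M) (dataA b δ m M L) (σ - 1)⁻¹ (θ / M)
  have hCS0 : 0 < CS := by
    refine lt_of_lt_of_le ?_ hCS
    unfold sobolevFactor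
    positivity
  set K' := CS * a ^ (1 / γ₀) with hK'
  have hK'0 : 0 < K' := by positivity
  refine luxNorm_le_of_modular_le_one (by simpa using mul_pos hK'0 hl) ENNReal.ofReal_ne_top ?_
  have hα : ∀ x, s x - Q x / p x ≤ -(θ / M) := by
    intro x
    have hp0 := h.integrability.pos x
    have h1 : s x - Q x / p x = -((Q x - s x * p x) / p x) := by
      field_simp
      ring
    rw [h1]
    refine neg_le_neg (div_le_div₀ (by linarith [hsp x]) (by linarith [hsp x]) hp0
      (h.integrability.le' hμ x))
  have hpt : ∀ᵐ x ∂μ.restrict (Metric.ball x₀ r₀),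
      (‖u x - u z‖ₑ / ENNReal.ofReal (K' * l)) ^ sobolevConj Q p s x ≤
        ENNReal.ofReal (((1 / b + V) * a)⁻¹ * (V * r₀ ^ (-Q x₀)) +
          ((1 / b + V) * a)⁻¹ * G x ^ p x) := by
    filter_upwards [ae_restrict_of_ae_restrict_of_subset hBE hS,
      ae_restrict_mem measurableSet_ball, hγγ₀] with x hxS hxB hxγ
    have hp0 := h.integrability.pos x
    have hxx₀ : dist x x₀ ≤ r₀ := (Metric.mem_ball.1 hxB).le
    obtain ⟨t, ht, htG, hle⟩ := hdata.abs_sub_le_of_subcritical (K := (σ - 1)⁻¹) (by positivity)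
      (by positivity : 0 < θ / M) hα hρ hρδ hxS (ball_sub_one_mul_subset hxB)
      (by rw [hρdef]; field_simp; exact hxx₀) hzS (Metric.mem_ball.1 hzx).le hGz
    have hγ0 : 0 ≤ sobolevConj Q p s x := by linarith
    have heq : ‖u x - u z‖ₑ / ENNReal.ofReal (K' * l) =
        ENNReal.ofReal (|u x / l - u z / l| / K') := by
      rw [← ofReal_norm, ← ENNReal.ofReal_div_of_pos (by positivity), ← sub_div,
        abs_div, abs_of_pos hl, Real.norm_eq_abs]
      congr 1
      field_simp
    rw [heq, ENNReal.ofReal_rpow_of_nonneg (by positivity) hγ0]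
    refine ENNReal.ofReal_le_ofReal ?_
    exact div_rpow_sobolevConj_le hm hb hb1 hba hP hV rfl hCS hγ₀ hxγ
      (sobolevConj_le hp0 (h.integrability.le' hμ x) (h.dimension.le' hμ x)
        hθ (hsp x)) ht (hdata.G_nonneg x) hρ htG (div_mul_cancel₀ _ hp0.ne')
      (mul_sobolevConj hp0 hθ (hsp x)) (abs_nonneg _) hle
      (rpow_neg_le_scaleConst hσ hL.le (h.dimension.hasLogModulus hμ)
        (fun x => (h.dimension.pos x).le) (h.dimension.le' hμ) hr₀ hρδ hxx₀)
  have hκ : 0 < (1 / b + V) * a := by positivity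
  refine (setLIntegral_le_of_ae_le_add_mul hBt.ne (by positivity) (by positivity)
    (fun x => Real.rpow_nonneg (hdata.G_nonneg x) _) hpt
    ((lintegral_mono_set hBE).trans hint)).trans ?_
  rw [ENNReal.ofReal_le_one]
  have h1 : ((1 / b + V) * a)⁻¹ * (V * r₀ ^ (-Q x₀)) * μ.real (Metric.ball x₀ r₀) +
      ((1 / b + V) * a)⁻¹ = ((1 / b + V) * a)⁻¹ * (V * a + 1) := by
    rw [hadef, Real.rpow_neg hr₀.le]
    ring
  rw [h1, inv_mul_le_one₀ hκ]
  -- The modular is at most `(V a + 1) / ((1/b + V) a)`, and `a ≥ b` makes this at most one.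
  have : 1 ≤ 1 / b * a := by
    rw [one_div_mul_eq_div]
    exact (one_le_div hb).2 hba
  linarith

/-- The rate `k` is tuned so that `J + 1` links give `2^{m(J+1)} ≤ (4ρ/t)^m`. As `ρ/t ≥ 1` and `m ≤
Q'`, this is at most `4^m (ρ/t)^{Q'}`, and the choice of `t` gives `(ρ/t)^{Q'} ≤ 1 + ρ^{Q'} G^{p'}`.
-/
lemma exp_mul_abs_le_of_le {k C J t ρ Q' q' p' G V y d : ℝ} (hm : 0 < m)
    (hC : 0 < C) (hk : k = m * Real.log 2 / C) (ht : 0 < t) (htρ : t ≤ ρ) (hmQ : m ≤ Q')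
    (hqp : q' * p' = Q') (hG : 0 ≤ G)
    (htG : t ^ (-q') = max G (ρ ^ (-q'))) (hJ : (2 : ℝ) ^ J ≤ 2 * (ρ / t)) (hd : d ≤ C * (J + 1))
    (hρ : ρ ^ Q' ≤ V * y) :
    Real.exp (k * d) ≤ 4 ^ m + 4 ^ m * (V * y) * G ^ p' := by
  have hρ0 : 0 < ρ := ht.trans_le htρ
  have hlog : 0 < Real.log 2 := Real.log_pos one_lt_two
  have hk0 : 0 < k := by
    rw [hk]
    positivity
  have h1 : (ρ / t) ^ Q' ≤ 1 + V * y * G ^ p' := by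
    calc (ρ / t) ^ Q' = ρ ^ Q' * (t ^ (-q')) ^ p' := by
          rw [Real.div_rpow hρ0.le ht.le, ← Real.rpow_mul ht.le, neg_mul, hqp,
            Real.rpow_neg ht.le, div_eq_mul_inv]
      _ ≤ ρ ^ Q' * (G ^ p' + (ρ ^ (-q')) ^ p') := by
          rw [htG]
          gcongr
          exact max_rpow_le_add hG (by positivity)
      _ = 1 + ρ ^ Q' * G ^ p' := by
          rw [← Real.rpow_mul hρ0.le, neg_mul, hqp, Real.rpow_neg hρ0.le]
          have : ρ ^ Q' ≠ 0 := by positivity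
          field_simp
          ring
      _ ≤ _ := by gcongr
  calc Real.exp (k * d) ≤ Real.exp (k * (C * (J + 1))) := by gcongr
    _ = (2 * 2 ^ J) ^ m := by
        rw [mul_comm 2, ← Real.rpow_add_one two_ne_zero, ← Real.rpow_mul zero_le_two,
          Real.rpow_def_of_pos zero_lt_two, hk]
        congr 1
        field_simp
    _ ≤ (4 * (ρ / t)) ^ m := by
        gcongr ?_ ^ m
        linarith
    _ = 4 ^ m * (ρ / t) ^ m := Real.mul_rpow (by norm_num) (by positivity)
    _ ≤ 4 ^ m * (ρ / t) ^ Q' := by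
        gcongr
        exact (one_le_div ht).2 htρ
    _ ≤ 4 ^ m * (1 + V * y * G ^ p') := by gcongr
    _ = _ := by ring

end Main

/-! ### The Hölder estimate and its constants. -/

section Holder

variable [MetricSpace X] {b σ δ m M L : ℝ} {Q p s : X → ℝ}

/-- The constant in the Hölder estimate on the set of full measure. -/
def morreyConst (b σ δ m M L θ : ℝ) : ℝ :=
  2 * powerConst δ (dataΛ m M L) (dataR m M) (dataA b δ m M L) (min 1 ((σ - 1) / 2))⁻¹ (θ / M) *
    oscFactor δ (dataΛ m M L + dataΛ m M L) (min 1 ((σ - 1) / 2))⁻¹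

lemma GradientData.abs_sub_le_of_mem_ball {θ : ℝ} {x₀ : X} {r₀ : ℝ} {E S : Set X} {v G : X → ℝ}
    (hσ : 1 < σ) (hM : 0 < M) (hθ : 0 < θ) (hr₀ : 0 < r₀) (hr₀δ : r₀ ≤ δ / σ)
    (hα : ∀ x, θ / M ≤ s x - Q x / p x) (hE : E = Metric.ball x₀ (σ * r₀))
    (hdata : GradientData δ (dataΛ m M L) (dataR m M) (dataA b δ m M L) E S s
      (fun x => Q x / p x) v G)
    {x y : X} (hx : x ∈ Metric.ball x₀ r₀) (hy : y ∈ Metric.ball x₀ r₀) (hxS : x ∈ S)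
    (hyS : y ∈ S) :
    |v x - v y| ≤ morreyConst b σ δ m M L θ * dist x y ^ holderExp Q p s x := by
  subst hE
  have hσ' : 0 < σ - 1 := sub_pos.2 hσ
  have hσr : σ * r₀ ≤ δ := by
    rw [le_div_iff₀ (by linarith)] at hr₀δ
    linarith
  have hd : dist x y ≤ 2 * r₀ := by
    have := dist_triangle_right x y x₀
    have := Metric.mem_ball.1 hx
    have := Metric.mem_ball.1 hy
    linarith
  -- Points of `B₀` are at distance at most `2 r₀`, so this `τ` keeps the chains inside `σ B₀`.
  have hτd : min 1 ((σ - 1) / 2) * dist x y ≤ (σ - 1) * r₀ := by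
    calc min 1 ((σ - 1) / 2) * dist x y ≤ (σ - 1) / 2 * (2 * r₀) := by
          gcongr
          exact min_le_right _ _
      _ = _ := by ring
  exact hdata.abs_sub_le_of_supercritical (lt_min one_pos (by linarith)) (min_le_left _ _)
    (by positivity) hα hxS hyS (by linarith)
    ((Metric.ball_subset_ball hτd).trans (ball_sub_one_mul_subset hx))
    ((Metric.ball_subset_ball hτd).trans (ball_sub_one_mul_subset hy))

lemma morreyConst_nonneg (hσ : 1 < σ) (hb : 0 < b) (hM : 0 < M) {θ : ℝ} (hθ : 0 < θ) : 0 ≤ morreyConst b σ δ m M L θ := by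
  have h1 := (inv_one_sub_two_rpow_neg_pos (a₀ := θ / M) (by positivity)).le
  have h2 : 0 < min 1 ((σ - 1) / 2) := lt_min one_pos (by linarith)
  unfold morreyConst powerConst chainConst linkConst dataA oscFactor
  positivity

end Holder

section Main

variable [MetricSpace X] [MeasurableSpace X] {μ : Measure X} {b σ δ m M L : ℝ} {Q p s : X → ℝ}

lemma Admissible.setLAverage_exp_le [BorelSpace X] (h : Admissible b δ m M L μ Q p s)
    (hσ : 1 < σ) (hb : 0 < b) (hm : 0 < m) (hL : 0 < L)
    (hsp : ∀ x, s x * p x = Q x) {x₀ : X} {r₀ : ℝ} (hr₀ : 0 < r₀)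
    (hr₀δ : r₀ ≤ δ / σ) {C : ℝ} (hC : 0 < C)
    (hCC : critConst δ (dataΛ m M L) (dataR m M) (dataA b δ m M L) (σ - 1)⁻¹ ≤ C)
    {v : X → ℝ} {G : X → ℝ} {S : Set X} (hv : AEMeasurable v (μ.restrict (Metric.ball x₀ r₀)))
    (hS : ∀ᵐ x ∂μ.restrict (Metric.ball x₀ (σ * r₀)), x ∈ S)
    (hdata : GradientData δ (dataΛ m M L) (dataR m M) (dataA b δ m M L)
      (Metric.ball x₀ (σ * r₀)) S s (fun x => Q x / p x) v G)
    (hint : ∫⁻ x in Metric.ball x₀ (σ * r₀), ENNReal.ofReal (G x ^ p x) ∂μ ≤ 1) :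
    IntegrableOn v (Metric.ball x₀ r₀) μ ∧
      ⨍⁻ x in Metric.ball x₀ r₀, ENNReal.ofReal (Real.exp (m * Real.log 2 / C *
        |v x - ⨍ y in Metric.ball x₀ r₀, v y ∂μ|)) ∂μ ≤
      ENNReal.ofReal (expBound b σ δ m M L * Real.exp (expBound b σ δ m M L)) := by
  have hμ := h.metricMeasure
  have hσ' : 0 < σ - 1 := sub_pos.2 hσ
  have hσ0 : 0 < σ := by linarith
  have hσr : σ * r₀ ≤ δ := by
    rw [le_div_iff₀ hσ0] at hr₀δ
    linarith
  have hrδ : r₀ ≤ δ := by nlinarith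
  set ρ := (σ - 1) * r₀ with hρdef
  have hρ : 0 < ρ := by positivity
  have hρδ : ρ ≤ δ := by
    rw [hρdef]
    linarith
  have hBE : Metric.ball x₀ r₀ ⊆ Metric.ball x₀ (σ * r₀) :=
    Metric.ball_subset_ball (by nlinarith)
  obtain ⟨z, hzS, hzx, hGz⟩ := hdata.pick x₀ ρ hρ hρδ
    (ball_sub_one_mul_subset (Metric.mem_ball_self hr₀))
  obtain ⟨hB0, hBt⟩ := hμ x₀ r₀ hr₀
  set V := scaleConst σ δ M L with hVdef
  have hV : 0 < V := scaleConst_pos hσ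
  have hlog : 0 < Real.log 2 := Real.log_pos one_lt_two
  have hT : 0 ≤ expBound b σ δ m M L := by
    unfold expBound
    positivity
  refine setLAverage_exp_abs_sub_average_le (c := v z) hB0.ne' hBt.ne hv (by positivity) hT ?_
  have hpt : ∀ᵐ x ∂μ.restrict (Metric.ball x₀ r₀),
      ENNReal.ofReal (Real.exp (m * Real.log 2 / C * |v x - v z|)) ≤
        ENNReal.ofReal (4 ^ m + 4 ^ m * (V * r₀ ^ Q x₀) * G x ^ p x) := by
    filter_upwards [ae_restrict_of_ae_restrict_of_subset hBE hS,
      ae_restrict_mem measurableSet_ball] with x hxS hxB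
    have hp0 := h.integrability.pos x
    have hxx₀ : dist x x₀ ≤ r₀ := (Metric.mem_ball.1 hxB).le
    obtain ⟨t, J, ht, htρ, htG, hJ, hle⟩ := hdata.abs_sub_le_of_critical (K := (σ - 1)⁻¹)
      (by positivity) (fun x => by rw [← hsp x, mul_div_cancel_right₀ _ (h.integrability.pos x).ne'])
      hρ hρδ hxS (ball_sub_one_mul_subset hxB) (by rw [hρdef]; field_simp; exact hxx₀) hzS
      (Metric.mem_ball.1 hzx).le hGz
    refine ENNReal.ofReal_le_ofReal ?_
    refine exp_mul_abs_le_of_le (J := J) hm hC rfl ht htρ (h.dimension.le hμ x)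
      (div_mul_cancel₀ _ hp0.ne') (hdata.G_nonneg x) htG (by simpa using hJ)
      (hle.trans (by gcongr)) ?_
    exact rpow_le_scaleConst hσ hL.le (h.dimension.hasLogModulus hμ)
        (fun x => (h.dimension.pos x).le) (h.dimension.le' hμ) hr₀ hρδ hxx₀
  refine (setLIntegral_le_of_ae_le_add_mul hBt.ne (by positivity) (by positivity)
    (fun x => Real.rpow_nonneg (hdata.G_nonneg x) _) hpt
    ((lintegral_mono_set hBE).trans hint)).trans ?_
  refine ENNReal.ofReal_le_ofReal ?_
  have h1 : r₀ ^ Q x₀ ≤ μ.real (Metric.ball x₀ r₀) / b := by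
    have := h.le_measureReal_div (x := x₀) hr₀ hrδ
    rw [le_div_iff₀ (by positivity)] at this
    rw [le_div_iff₀ hb]
    linarith
  calc 4 ^ m * μ.real (Metric.ball x₀ r₀) + 4 ^ m * (V * r₀ ^ Q x₀)
      ≤ 4 ^ m * μ.real (Metric.ball x₀ r₀) +
        4 ^ m * (V * (μ.real (Metric.ball x₀ r₀) / b)) := by gcongr
    _ = _ := by
      rw [expBound]
      ring

/-- The Hölder estimate on a set of full measure, in terms of the Luxemburg quasi-norm. -/
lemma Admissible.exists_ae_abs_sub_le [BorelSpace X] (h : Admissible b δ m M L μ Q p s)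
    (hδ : 0 < δ)
    (hσ : 1 < σ) (hb : 0 < b) (hb1 : b ≤ 1) (hm : 0 < m) (hM : 0 < M) (hL : 0 < L) {θ : ℝ}
    (hθ : 0 < θ) (hα : ∀ x, θ / M ≤ holderExp Q p s x) {x₀ : X} {r₀ : ℝ} (hr₀ : 0 < r₀)
    (hr₀δ : r₀ ≤ δ / σ) {u : X → ℝ} {g : X → ℝ≥0∞}
    (hug : IsHajlaszPair μ (Metric.ball x₀ (σ * r₀)) s p u g) :
    ∃ S : Set X, (∀ᵐ x ∂μ.restrict (Metric.ball x₀ (σ * r₀)), x ∈ S) ∧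
      ∀ x ∈ Metric.ball x₀ r₀, x ∈ S → ∀ y ∈ Metric.ball x₀ r₀, y ∈ S →
        |u x - u y| ≤ morreyConst b σ δ m M L θ *
          (luxNorm (μ.restrict (Metric.ball x₀ (σ * r₀))) p g).toReal *
          dist x y ^ holderExp Q p s x := by
  obtain ⟨S, hS, hdata⟩ := h.exists_gradientData hδ hb hb1 hm hM hL measurableSet_ball hug
  refine ⟨S, hS, fun x hx hxS y hy hyS => ?_⟩
  have hfin := luxNorm_lt_top hm (h.integrability.le h.metricMeasure) hug.2.2.2
  set n := luxNorm (μ.restrict (Metric.ball x₀ (σ * r₀))) p g with hn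
  have key : |u x - u y| ≤
      morreyConst b σ δ m M L θ * dist x y ^ holderExp Q p s x * n.toReal := by
    refine le_mul_of_forall_gt_le_mul fun l hl => ?_
    have hl0 : 0 < l := ENNReal.toReal_nonneg.trans_lt hl
    obtain ⟨hd, -⟩ := hdata l hl0 ((ENNReal.lt_ofReal_iff_toReal_lt hfin.ne).2 hl)
    have := hd.abs_sub_le_of_mem_ball hσ hM hθ hr₀ hr₀δ hα rfl hx hy hxS hyS
    rwa [← sub_div, abs_div, abs_of_pos hl0, div_le_iff₀ hl0] at this
  linarith

lemma holderExp_le (hμ : IsMetricMeasure μ) (hs : IsLogHolderExponent μ m M L s)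
    (hQ : ∀ x, 0 < Q x) (hp : ∀ x, 0 < p x) (x : X) : holderExp Q p s x ≤ M := by
  have h1 := hs.le' hμ x
  have h2 : 0 < Q x / p x := div_pos (hQ x) (hp x)
  unfold holderExp
  linarith

lemma Admissible.hasLogModulus_holderExp (h : Admissible b δ m M L μ Q p s) (hm : 0 < m)
    (hM : 0 < M) : HasLogModulus (dataΛ m M L) (holderExp Q p s) :=
  (h.smoothness.hasLogModulus h.metricMeasure).add
    (IsLogHolderExponent.hasLogModulus_div hm hM.le h.metricMeasure h.integrability
      h.dimension).neg

/-- The factor passing from the Hölder estimate to the bound for the deviation from the mean. -/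
def oscBoundFactor (δ m M L : ℝ) : ℝ := 2 ^ M * oscFactor δ (dataΛ m M L) 1

lemma Admissible.two_mul_rpow_holderExp_le (h : Admissible b δ m M L μ Q p s) (hm : 0 < m)
    (hM : 0 < M) (hL : 0 < L) {x x₀ : X} {r₀ : ℝ} (hr₀ : 0 < r₀) (hr : r₀ ≤ δ)
    (hx : dist x x₀ ≤ r₀) :
    (2 * r₀) ^ holderExp Q p s x ≤ oscBoundFactor δ m M L * r₀ ^ holderExp Q p s x₀ := by
  rw [Real.mul_rpow zero_le_two hr₀.le, oscBoundFactor, mul_assoc]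
  refine mul_le_mul (Real.rpow_le_rpow_of_exponent_le one_le_two
    (holderExp_le h.metricMeasure h.smoothness h.dimension.pos h.integrability.pos x)) ?_
    (by positivity) (by positivity)
  exact (h.hasLogModulus_holderExp hm hM).rpow_le (by unfold dataΛ; positivity) zero_le_one hr₀ hr
    (by rwa [one_mul])

/-- The base `σδ / ((σ-1) r)` is at least one for `r ≤ δ`, so the required constant is no smaller
than the one the chaining yields. -/
lemma le_holderConst {C a r : ℝ} (hσ : 1 < σ) (hδ : 0 < δ) (hr : 0 < r) (hrδ : r ≤ δ)
    (hC : 0 ≤ C) (ha : 0 ≤ a) : C ≤ holderConst σ δ C a r := by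
  have h1 : (1 : ℝ) ≤ 2 ^ (a + 1) := Real.one_le_rpow one_le_two (by linarith)
  have h2 : 1 ≤ (σ * δ / ((σ - 1) * r)) ^ a := by
    refine Real.one_le_rpow ?_ ha
    have : 0 < σ - 1 := by linarith
    rw [one_le_div (by positivity)]
    nlinarith
  unfold holderConst
  calc C = 1 * C * 1 := by ring
    _ ≤ _ := by gcongr

lemma essSup_holderExp_nonneg [Nonempty X] (h : Admissible b δ m M L μ Q p s)
    (hα : ∀ x, 0 ≤ holderExp Q p s x) : 0 ≤ essSup (holderExp Q p s) μ := by
  have hμ := h.metricMeasure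
  have hne : (ae μ).NeBot := by
    refine ae_neBot.2 fun h0 => ?_
    have := (hμ (Classical.arbitrary X) 1 one_pos).1
    simp [h0] at this
  have hle : ∀ᵐ x ∂μ, holderExp Q p s x ≤ essSup (holderExp Q p s) μ :=
    ae_le_essSup ⟨M, eventually_map.2 (Eventually.of_forall
      (holderExp_le hμ h.smoothness h.dimension.pos h.integrability.pos))⟩
  obtain ⟨x, hx⟩ := hle.exists
  exact (hα x).trans hx

end Main

end VarExp

end

/-! ### The three inequalities. -/

open VarExp in
theorem VarExp.sobolev_poincare (b σ δ m M L : ℝ) (hb : 0 < b) (hb1 : b ≤ 1) (hσ : 1 < σ)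
    (hδ : 0 < δ) (hm : 0 < m) (hM : 0 < M) (hL : 0 < L) (θ : ℝ) (hθ : 0 < θ) : ∃ CS : ℝ, 0 < CS ∧
      ∀ (X : Type u) [MetricSpace X] [MeasurableSpace X] [BorelSpace X] (μ : Measure X)
        (Q p s : X → ℝ), VarExp.Admissible b δ m M L μ Q p s →
        (∀ᵐ x ∂μ, s x * p x + θ ≤ Q x) →
        ∀ (x₀ : X) (r₀ : ℝ), 0 < r₀ → r₀ ≤ δ / σ →
        ∀ (u : X → ℝ) (g : X → ℝ≥0∞),
          VarExp.IsHajlaszPair μ (Metric.ball x₀ (σ * r₀)) s p u g →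
          (⨅ c : ℝ, VarExp.luxNorm (μ.restrict (Metric.ball x₀ r₀)) (VarExp.sobolevConj Q p s)
              (fun x => ‖u x - c‖ₑ)) ≤
            ENNReal.ofReal (CS * (μ.real (Metric.ball x₀ r₀) / r₀ ^ Q x₀) ^
                (1 / essInf (VarExp.sobolevConj Q p s) (μ.restrict (Metric.ball x₀ r₀)))) *
              VarExp.luxNorm (μ.restrict (Metric.ball x₀ (σ * r₀))) p g := by
  refine ⟨max 1 (powerConst δ (dataΛ m M L) (dataR m M) (dataA b δ m M L) (σ - 1)⁻¹ (θ / M) *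
      sobolevFactor b σ δ m M L θ), lt_max_of_lt_left one_pos, ?_⟩
  intro X _ _ _ μ Q p s h hsp x₀ r₀ hr₀ hr₀δ u g hug
  have hsp' : ∀ x, s x * p x + θ ≤ Q x := h.metricMeasure.forall_le_of_ae
    ((h.smoothness.continuous.mul h.integrability.continuous).add continuous_const)
    h.dimension.continuous hsp
  obtain ⟨S, hS, hdata⟩ := h.exists_gradientData hδ hb hb1 hm hM hL measurableSet_ball hug
  have hfin := luxNorm_lt_top hm (h.integrability.le h.metricMeasure) hug.2.2.2
  set n := luxNorm (μ.restrict (Metric.ball x₀ (σ * r₀))) p g with hn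
  set K' := max 1 (powerConst δ (dataΛ m M L) (dataR m M) (dataA b δ m M L) (σ - 1)⁻¹ (θ / M) *
      sobolevFactor b σ δ m M L θ) * (μ.real (Metric.ball x₀ r₀) / r₀ ^ Q x₀) ^
        (1 / essInf (VarExp.sobolevConj Q p s) (μ.restrict (Metric.ball x₀ r₀))) with hK'
  have hK'0 : 0 ≤ K' := by positivity
  rw [← ENNReal.ofReal_toReal hfin.ne, ← ENNReal.ofReal_mul hK'0]
  -- The estimate holds for each `l > ‖g‖`, with a constant `c` that may depend on `l`. The infimum
  -- over `c` does not, so `l` can decrease to the norm.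
  have h1 : Filter.Tendsto (fun l : ℝ => ENNReal.ofReal (K' * l))
      (nhdsWithin n.toReal (Ioi n.toReal)) (nhds (ENNReal.ofReal (K' * n.toReal))) :=
    ((ENNReal.continuous_ofReal.comp (continuous_const.mul continuous_id)).tendsto
      n.toReal).mono_left nhdsWithin_le_nhds
  refine ge_of_tendsto h1 ?_
  filter_upwards [self_mem_nhdsWithin] with l hl
  have hl0 : 0 < l := ENNReal.toReal_nonneg.trans_lt hl
  obtain ⟨hd, hint⟩ := hdata l hl0 ((ENNReal.lt_ofReal_iff_toReal_lt hfin.ne).2 hl)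
  obtain ⟨c, hc⟩ := h.luxNorm_sobolevConj_le hσ hb hb1 hm hM hL hθ hsp' hr₀ hr₀δ
    (le_max_right 1 _) hl0 hS hd hint
  exact (iInf_le _ c).trans hc

open VarExp in
theorem VarExp.moser_trudinger (b σ δ m M L : ℝ) (hb : 0 < b) (hb1 : b ≤ 1) (hσ : 1 < σ)
    (hδ : 0 < δ) (hm : 0 < m) (hM : 0 < M) (hL : 0 < L) : ∃ C₁ C₂ : ℝ, 0 < C₁ ∧ 0 < C₂ ∧
      ∀ (X : Type u) [MetricSpace X] [MeasurableSpace X] [BorelSpace X] (μ : Measure X)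
        (Q p s : X → ℝ), VarExp.Admissible b δ m M L μ Q p s →
        (∀ x, s x * p x = Q x) →
        ∀ (x₀ : X) (r₀ : ℝ), 0 < r₀ → r₀ ≤ δ / σ →
        ∀ (u : X → ℝ) (g : X → ℝ≥0∞),
          VarExp.IsHajlaszPair μ (Metric.ball x₀ (σ * r₀)) s p u g →
          IntegrableOn u (Metric.ball x₀ r₀) μ ∧
          (0 < VarExp.luxNorm (μ.restrict (Metric.ball x₀ (σ * r₀))) p g →
            (⨍⁻ x in Metric.ball x₀ r₀, ENNReal.ofReal (Real.exp
                (C₁ * (|u x - ⨍ y in Metric.ball x₀ r₀, u y ∂μ| /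
                  (VarExp.luxNorm (μ.restrict (Metric.ball x₀ (σ * r₀))) p g).toReal))) ∂μ) ≤
              ENNReal.ofReal C₂) := by
  set C := max 1 (critConst δ (dataΛ m M L) (dataR m M) (dataA b δ m M L) (σ - 1)⁻¹) with hC
  have hC0 : 0 < C := lt_max_of_lt_left one_pos
  have hlog : 0 < Real.log 2 := Real.log_pos one_lt_two
  -- The final factor `1/2` pays for the normalisation `l = 2 ‖g‖`, which exceeds the norm strictly
  -- when the norm is positive and so avoids a limit.
  refine ⟨m * Real.log 2 / C / 2, expBound b σ δ m M L * Real.exp (expBound b σ δ m M L),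
    by positivity, ?_, ?_⟩
  · have := scaleConst_pos (δ := δ) (M := M) (L := L) hσ
    unfold expBound
    positivity
  intro X _ _ _ μ Q p s h hsp x₀ r₀ hr₀ hr₀δ u g hug
  obtain ⟨S, hS, hdata⟩ := h.exists_gradientData hδ hb hb1 hm hM hL measurableSet_ball hug
  have hfin := luxNorm_lt_top hm (h.integrability.le h.metricMeasure) hug.2.2.2
  set n := luxNorm (μ.restrict (Metric.ball x₀ (σ * r₀))) p g with hn
  have hum : AEMeasurable u (μ.restrict (Metric.ball x₀ r₀)) :=
    hug.1.1.mono_measure (Measure.restrict_mono_set _ (Metric.ball_subset_ball (by nlinarith)))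
  have key := fun l (hl : n.toReal < l) =>
    have hl0 : 0 < l := ENNReal.toReal_nonneg.trans_lt hl
    have hd := hdata l hl0 ((ENNReal.lt_ofReal_iff_toReal_lt hfin.ne).2 hl)
    h.setLAverage_exp_le hσ hb hm hL hsp hr₀ hr₀δ hC0 (le_max_right 1 _) (hum.div_const l) hS
      hd.1 hd.2
  refine ⟨?_, fun hn0 => ?_⟩
  -- Integrability must also cover norm zero, hence `l = ‖g‖ + 1`.
  · have hl0 : n.toReal + 1 ≠ 0 := by
      have := ENNReal.toReal_nonneg (a := n)
      positivity
    refine ((key (n.toReal + 1) (lt_add_one _)).1.mul_const (n.toReal + 1)).congr ?_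
    filter_upwards with x
    exact div_mul_cancel₀ _ hl0
  · have hnr : 0 < n.toReal := ENNReal.toReal_pos hn0.ne' hfin.ne
    refine le_trans (le_of_eq ?_) (key (2 * n.toReal) (by linarith)).2
    refine congrArg _ (funext fun x => ?_)
    have h1 : ⨍ y in Metric.ball x₀ r₀, u y / (2 * n.toReal) ∂μ =
        (⨍ y in Metric.ball x₀ r₀, u y ∂μ) / (2 * n.toReal) := by
      rw [setAverage_eq, setAverage_eq, integral_div, smul_eq_mul, smul_eq_mul, mul_div_assoc]
    rw [h1, ← sub_div, abs_div, abs_of_pos (by positivity : 0 < 2 * n.toReal)]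
    congr 2
    field_simp

open VarExp in
theorem VarExp.morrey (b σ δ m M L : ℝ) (hb : 0 < b) (hb1 : b ≤ 1) (hσ : 1 < σ)
    (hδ : 0 < δ) (hm : 0 < m) (hM : 0 < M) (hL : 0 < L) (θ : ℝ) (hθ : 0 < θ) : ∃ CH : ℝ, 0 < CH ∧
      ∀ (X : Type u) [MetricSpace X] [MeasurableSpace X] [BorelSpace X] (μ : Measure X)
        (Q p s : X → ℝ), VarExp.Admissible b δ m M L μ Q p s →
        (∀ᵐ x ∂μ, Q x + θ ≤ s x * p x) →
        ∀ (x₀ : X) (r₀ : ℝ), 0 < r₀ → r₀ ≤ δ / σ →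
        ∀ (u : X → ℝ) (g : X → ℝ≥0∞),
          VarExp.IsHajlaszPair μ (Metric.ball x₀ (σ * r₀)) s p u g →
          IntegrableOn u (Metric.ball x₀ r₀) μ ∧
          eLpNorm (fun x => u x - ⨍ y in Metric.ball x₀ r₀, u y ∂μ) ∞
              (μ.restrict (Metric.ball x₀ r₀)) ≤
            ENNReal.ofReal (CH * r₀ ^ VarExp.holderExp Q p s x₀) *
              VarExp.luxNorm (μ.restrict (Metric.ball x₀ (σ * r₀))) p g ∧
          ∃ v : X → ℝ, ContinuousOn v (Metric.ball x₀ r₀) ∧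
            u =ᵐ[μ.restrict (Metric.ball x₀ r₀)] v ∧
            ∀ x ∈ Metric.ball x₀ r₀, ∀ y ∈ Metric.ball x₀ r₀,
              |v x - v y| ≤
                VarExp.holderConst σ δ CH (essSup (VarExp.holderExp Q p s) μ) r₀ *
                  (VarExp.luxNorm (μ.restrict (Metric.ball x₀ (σ * r₀))) p g).toReal *
                  dist x y ^ VarExp.holderExp Q p s x := by
  set C := morreyConst b σ δ m M L θ with hC
  have hC0 : 0 ≤ C := morreyConst_nonneg hσ hb hM hθ
  set D := oscBoundFactor δ m M L with hD
  have hD0 : 0 ≤ D := by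
    rw [hD]
    unfold oscBoundFactor oscFactor
    positivity
  -- The term `C * D` serves the deviation from the mean, `C` the Hölder estimate, and `1` ensures
  -- positivity.
  refine ⟨1 + C + C * D, by positivity, ?_⟩
  intro X _ _ _ μ Q p s h hsp x₀ r₀ hr₀ hr₀δ u g hug
  have hμ := h.metricMeasure
  have hsp' : ∀ x, Q x + θ ≤ s x * p x := hμ.forall_le_of_ae
    (h.dimension.continuous.add continuous_const)
    (h.smoothness.continuous.mul h.integrability.continuous) hsp
  have hα : ∀ x, θ / M ≤ holderExp Q p s x := by
    intro x
    have hp0 := h.integrability.pos x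
    have h1 : holderExp Q p s x = (s x * p x - Q x) / p x := by
      unfold holderExp
      field_simp
    rw [h1]
    exact div_le_div₀ (by linarith [hsp' x]) (by linarith [hsp' x]) hp0
      (h.integrability.le' hμ x)
  have hθM : 0 < θ / M := by positivity
  have hrδ : r₀ ≤ δ := hr₀δ.trans (div_le_self hδ.le hσ.le)
  obtain ⟨S, hS, hSu⟩ := h.exists_ae_abs_sub_le hδ hσ hb hb1 hm hM hL hθ hα hr₀ hr₀δ hug
  rw [← hC] at hSu
  have hfin := luxNorm_lt_top hm (h.integrability.le hμ) hug.2.2.2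
  set n := luxNorm (μ.restrict (Metric.ball x₀ (σ * r₀))) p g with hn
  have hn0 : 0 ≤ n.toReal := ENNReal.toReal_nonneg
  have hBE : Metric.ball x₀ r₀ ⊆ Metric.ball x₀ (σ * r₀) :=
    Metric.ball_subset_ball (by nlinarith)
  have hSB := ae_restrict_of_ae_restrict_of_subset hBE hS
  have hum : AEMeasurable u (μ.restrict (Metric.ball x₀ r₀)) :=
    hug.1.1.mono_measure (Measure.restrict_mono_set _ hBE)
  obtain ⟨hB0, hBt⟩ := hμ x₀ r₀ hr₀
  have hosc : ∀ x ∈ Metric.ball x₀ r₀, x ∈ S → ∀ y ∈ Metric.ball x₀ r₀, y ∈ S →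
      |u x - u y| ≤ (1 + C + C * D) * r₀ ^ holderExp Q p s x₀ * n.toReal := by
    intro x hx hxS y hy hyS
    have hd : dist x y ≤ 2 * r₀ := by
      have := dist_triangle_right x y x₀
      have := Metric.mem_ball.1 hx
      have := Metric.mem_ball.1 hy
      linarith
    calc |u x - u y| ≤ C * n.toReal * dist x y ^ holderExp Q p s x := hSu x hx hxS y hy hyS
      _ ≤ C * n.toReal * (D * r₀ ^ holderExp Q p s x₀) := by
        gcongr
        exact (Real.rpow_le_rpow dist_nonneg hd (hθM.le.trans (hα x))).trans
          (h.two_mul_rpow_holderExp_le hm hM hL hr₀ hrδ (Metric.mem_ball.1 hx).le)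
      _ = C * D * r₀ ^ holderExp Q p s x₀ * n.toReal := by ring
      _ ≤ _ := by
        gcongr
        linarith
  obtain ⟨hui, hdev⟩ := integrableOn_and_eLpNorm_sub_average_le measurableSet_ball hB0.ne' hBt.ne
    hum hSB hosc
  refine ⟨hui, ?_, ?_⟩
  · rwa [ENNReal.ofReal_mul (by positivity), ENNReal.ofReal_toReal hfin.ne] at hdev
  -- Every ball has positive measure, so a set of full measure in `B₀` is dense there.
  have hdense : Metric.ball x₀ r₀ ⊆ closure (Metric.ball x₀ r₀ ∩ S) := by
    have h1 := hμ.dense_of_ae ((ae_restrict_iff' measurableSet_ball).1 hSB)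
    intro x hx
    have h2 := Metric.isOpen_ball.inter_closure ⟨hx, h1 x⟩
    refine closure_mono ?_ h2
    intro y hy
    exact ⟨hy.1, hy.2 hy.1⟩
  obtain ⟨v, hvc, hvu, hvh⟩ := exists_continuousOn_extension hdense (C := C * n.toReal)
    (by positivity) hθM (h.hasLogModulus_holderExp hm hM).continuous hα
    (fun x hx y hy => hSu x hx.1 hx.2 y hy.1 hy.2)
  refine ⟨v, hvc, ?_, fun x hx y hy => (hvh x hx y hy).trans ?_⟩
  · filter_upwards [hSB, ae_restrict_mem measurableSet_ball] with x hxS hxB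
    exact (hvu x ⟨hxB, hxS⟩ hxB).symm
  have : Nonempty X := ⟨x₀⟩
  have h3 := essSup_holderExp_nonneg h fun x => hθM.le.trans (hα x)
  gcongr
  calc C ≤ 1 + C + C * D := by
        have := mul_nonneg hC0 hD0
        linarith
    _ ≤ _ := le_holderConst hσ hδ hr₀ hrδ (by positivity) h3

theorem mainTheorem1 (b σ δ m M L : ℝ) (hb : 0 < b) (hb1 : b ≤ 1) (hσ : 1 < σ) (hδ : 0 < δ)
    (hm : 0 < m) (hL : 0 < L) :
    -- (i) Sobolev–Poincaré
    (∀ θ : ℝ, 0 < θ → ∃ CS : ℝ, 0 < CS ∧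
      ∀ (X : Type u) [MetricSpace X] [MeasurableSpace X] [BorelSpace X] (μ : Measure X)
        (Q p s : X → ℝ), VarExp.Admissible b δ m M L μ Q p s →
        (∀ᵐ x ∂μ, s x * p x + θ ≤ Q x) →
        ∀ (x₀ : X) (r₀ : ℝ), 0 < r₀ → r₀ ≤ δ / σ →
        ∀ (u : X → ℝ) (g : X → ℝ≥0∞),
          VarExp.IsHajlaszPair μ (Metric.ball x₀ (σ * r₀)) s p u g →
          (⨅ c : ℝ, VarExp.luxNorm (μ.restrict (Metric.ball x₀ r₀)) (VarExp.sobolevConj Q p s)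
              (fun x => ‖u x - c‖ₑ)) ≤
            ENNReal.ofReal (CS * (μ.real (Metric.ball x₀ r₀) / r₀ ^ Q x₀) ^
                (1 / essInf (VarExp.sobolevConj Q p s) (μ.restrict (Metric.ball x₀ r₀)))) *
              VarExp.luxNorm (μ.restrict (Metric.ball x₀ (σ * r₀))) p g) ∧
    -- (ii) Moser–Trudinger
    (∃ C₁ C₂ : ℝ, 0 < C₁ ∧ 0 < C₂ ∧
      ∀ (X : Type u) [MetricSpace X] [MeasurableSpace X] [BorelSpace X] (μ : Measure X)
        (Q p s : X → ℝ), VarExp.Admissible b δ m M L μ Q p s →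
        (∀ x, s x * p x = Q x) →
        ∀ (x₀ : X) (r₀ : ℝ), 0 < r₀ → r₀ ≤ δ / σ →
        ∀ (u : X → ℝ) (g : X → ℝ≥0∞),
          VarExp.IsHajlaszPair μ (Metric.ball x₀ (σ * r₀)) s p u g →
          IntegrableOn u (Metric.ball x₀ r₀) μ ∧
          (0 < VarExp.luxNorm (μ.restrict (Metric.ball x₀ (σ * r₀))) p g →
            (⨍⁻ x in Metric.ball x₀ r₀, ENNReal.ofReal (Real.exp
                (C₁ * (|u x - ⨍ y in Metric.ball x₀ r₀, u y ∂μ| /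
                  (VarExp.luxNorm (μ.restrict (Metric.ball x₀ (σ * r₀))) p g).toReal))) ∂μ) ≤
              ENNReal.ofReal C₂)) ∧
    -- (iii) Morrey
    (∀ θ : ℝ, 0 < θ → ∃ CH : ℝ, 0 < CH ∧
      ∀ (X : Type u) [MetricSpace X] [MeasurableSpace X] [BorelSpace X] (μ : Measure X)
        (Q p s : X → ℝ), VarExp.Admissible b δ m M L μ Q p s →
        (∀ᵐ x ∂μ, Q x + θ ≤ s x * p x) →
        ∀ (x₀ : X) (r₀ : ℝ), 0 < r₀ → r₀ ≤ δ / σ →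
        ∀ (u : X → ℝ) (g : X → ℝ≥0∞),
          VarExp.IsHajlaszPair μ (Metric.ball x₀ (σ * r₀)) s p u g →
          IntegrableOn u (Metric.ball x₀ r₀) μ ∧
          eLpNorm (fun x => u x - ⨍ y in Metric.ball x₀ r₀, u y ∂μ) ∞
              (μ.restrict (Metric.ball x₀ r₀)) ≤
            ENNReal.ofReal (CH * r₀ ^ VarExp.holderExp Q p s x₀) *
              VarExp.luxNorm (μ.restrict (Metric.ball x₀ (σ * r₀))) p g ∧
          ∃ v : X → ℝ, ContinuousOn v (Metric.ball x₀ r₀) ∧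
            u =ᵐ[μ.restrict (Metric.ball x₀ r₀)] v ∧
            ∀ x ∈ Metric.ball x₀ r₀, ∀ y ∈ Metric.ball x₀ r₀,
              |v x - v y| ≤
                VarExp.holderConst σ δ CH (essSup (VarExp.holderExp Q p s) μ) r₀ *
                  (VarExp.luxNorm (μ.restrict (Metric.ball x₀ (σ * r₀))) p g).toReal *
                  dist x y ^ VarExp.holderExp Q p s x) := by
  -- For `M ≤ 0` the bounds `0 < Q ≤ M` at `x₀` are contradictory, so any constants do.
  rcases le_or_gt M 0 with hM | hM
  · have hfalse : ∀ (X : Type u) [MetricSpace X] [MeasurableSpace X] (μ : Measure X)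
        (Q p s : X → ℝ), VarExp.Admissible b δ m M L μ Q p s → X → False := by
      intro X _ _ μ Q p s h x
      linarith [h.dimension.pos x, h.dimension.le' h.metricMeasure x]
    exact ⟨fun _ _ => ⟨1, one_pos, fun X _ _ _ μ Q p s h _ x₀ => (hfalse X μ Q p s h x₀).elim⟩,
      ⟨1, 1, one_pos, one_pos, fun X _ _ _ μ Q p s h _ x₀ => (hfalse X μ Q p s h x₀).elim⟩,
      fun _ _ => ⟨1, one_pos, fun X _ _ _ μ Q p s h _ x₀ => (hfalse X μ Q p s h x₀).elim⟩⟩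
  · exact ⟨fun θ hθ => VarExp.sobolev_poincare b σ δ m M L hb hb1 hσ hδ hm hM hL θ hθ,
      VarExp.moser_trudinger b σ δ m M L hb hb1 hσ hδ hm hM hL,
      fun θ hθ => VarExp.morrey b σ δ m M L hb hb1 hσ hδ hm hM hL θ hθ⟩
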